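/- **Conventions.** A double category $\mathbb A$ has objects, horizontal morphisms $A\rightarrowtail B$ and vertical morphisms $A\rightsquigarrow B$ (two category structures on the same objects), and squares with horizontal top and bottom and vertical sides, closed under horizontal and vertical composition and containing the identity squares; a boundary is filled by at most one square. An *ACGW category* is a double category $\mathbb A$ such that: * there is an object $\varnothing$ that is initial for the horizontal and for the vertical morphisms; all horizontal and all vertical morphisms are monic; the horizontal category and the vertical category have pullbacks; * isomorphisms are shared: there is an identity-on-objects isomorphism $\varphi$ between the groupoids of horizontal and of vertical isomorphisms, such that a boundary whose two horizontal (or two vertical) sides are isomorphisms is a square if and only if it commutes after transporting these sides along $\varphi$; * each horizontal $f\colon A\rightarrowtail B$ has an assigned cokernel, a vertical $c(f)\colon B/A\rightsquigarrow B$, and each vertical $a\colon A\rightsquigarrow B$ has an assigned kernel, a horizontal $k(a)\colon B\backslash A\rightarrowtail B$; $c$ and $k$ are mutually inverse up to isomorphism over $B$, and they extend, keeping codomains, to equivalences $c$ from (horizontal morphisms, squares) to (vertical morphisms, pullback squares) and $k$ from (vertical morphisms, squares) to (horizontal morphisms, pullback squares); * for every $f\colon A\rightarrowtail B$ the diagram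 with top $\varnothing\rightarrowtail B/A$, left side $\varnothing\rightsquigarrow A$, right side $c(f)$ and bottom $f$ is a square, and dually for every vertical morphism and its kernel. Then every $A'\rightarrowtail B'\leftsquigarrow B$ is completed, uniquely up to isomorphism, to a square with a corner $A'\oslash_{B'}B$. A *complementary pair* is a pair $A\rightarrowtail B\leftsquigarrow D$ in which the vertical morphism is isomorphic to the cokernel of the horizontal one. The category $\mathbb A^\flat$ has the objects of $\mathbb A$; its morphisms $A\to B$ are isomorphism classes of spans $A\leftsquigarrow\bar A\rightarrowtail B$, composed by means of $\oslash$; its zero morphisms are the spans with $\bar A=\varnothing$. A horizontal $A\rightarrowtail B$ is regarded as a morphism $A\to B$ of $\mathbb A^\flat$, and a vertical $A\rightsquigarrow B$ as a morphism $B\to A$ of $\mathbb A^\flat$. A *chain complex* $X_\bullet$ in $\mathbb A$ is a sequence of spans $d_i\colon X_i\leftsquigarrow\bar X_i\rightarrowtail X_{i-1}$, $i\in\mathbb Z$, with $d_id_{i+1}=0$ in $\mathbb A^\flat$, that is, such that $\varnothing\rightarrowtail\bar X_i$, $\varnothing\rightsquigarrow\bar X_{i+1}$, $\bar X_i\rightsquigarrow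 X_i$, $\bar X_{i+1}\rightarrowtail X_i$ bound a square. Its homology $H_i(X)$ is obtained from this square by taking complements in both directions: $\bar X_{i+1}\rightarrowtail X_i$ factors through $K_i(X):=X_i\backslash\bar X_i\rightarrowtail X_i$, and $\bar X_i\rightsquigarrow X_i$ factors through $X_i/\bar X_{i+1}\rightsquigarrow X_i$; the object $H_i(X)$ comes with $H_i(X)\rightsquigarrow K_i(X)$, the cokernel of $\bar X_{i+1}\rightarrowtail K_i(X)$, and with $H_i(X)\rightarrowtail X_i/\bar X_{i+1}$, the kernel of $\bar X_i\rightsquigarrow X_i/\bar X_{i+1}$, and these form a square with $K_i(X)\rightarrowtail X_i\leftsquigarrow X_i/\bar X_{i+1}$. A complex is *exact* if $H_i\cong\varnothing$ for all $i$. A horizontal morphism $X_\bullet\rightarrowtail Y_\bullet$ of complexes consists of horizontal $X_i\rightarrowtail Y_i$ and $\bar X_i\rightarrowtail\bar Y_i$ that form squares with $\bar X_i\rightsquigarrow X_i$, $\bar Y_i\rightsquigarrow Y_i$ and commute with $\bar X_i\rightarrowtail X_{i-1}$, $\bar Y_i\rightarrowtail Y_{i-1}$. A vertical morphism $Z_\bullet\rightsquigarrow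 Y_\bullet$ consists of vertical $Z_i\rightsquigarrow Y_i$ and $\bar Z_i\rightsquigarrow\bar Y_i$ that commute with $\bar Z_i\rightsquigarrow Z_i$, $\bar Y_i\rightsquigarrow Y_i$ and form squares with $\bar Z_i\rightarrowtail Z_{i-1}$, $\bar Y_i\rightarrowtail Y_{i-1}$. Such a pair $X_\bullet\rightarrowtail Y_\bullet\leftsquigarrow Z_\bullet$ is a *short exact sequence*, $Z_\bullet=Y_\bullet/X_\bullet$, if $X_i\rightarrowtail Y_i\leftsquigarrow Z_i$ is a complementary pair for every $i$. **Theorem (long exact sequence in homology for ACGW categories).** Let $\mathbb A$ be an ACGW category and let $X_\bullet\overset{f}{\rightarrowtail}Y_\bullet\overset{g}{\leftsquigarrow}Z_\bullet=Y_\bullet/X_\bullet$ be a short exact sequence of chain complexes in $\mathbb A$. Then there is an exact chain complex in $\mathbb A^\flat$ $$\cdots\to H_{i+1}(Y)\xrightarrow{\beta_{i+1}} H_{i+1}(Y/X)\xrightarrow{\delta_i}H_i(X)\xrightarrow{\alpha_i}H_i(Y)\xrightarrow{\beta_i}H_i(Y/X)\xrightarrow{\delta_{i-1}}H_{i-1}(X)\to\cdots$$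 whose morphisms are induced by the short exact sequence in the following sense (all equations are in $\mathbb A^\flat$, and $K_i(-)\to H_i(-)$ and $K_i(-)\to(-)_i$ denote the morphisms given by $H_i(-)\rightsquigarrow K_i(-)$ and $K_i(-)\rightarrowtail(-)_i$): * $\alpha_i$ and $\beta_i$ are induced by $f_i\colon X_i\to Y_i$ and $g_i\colon Y_i\to Z_i$: there is $l\colon K_i(X)\to K_i(Y)$ such that $K_i(X)\xrightarrow{l}K_i(Y)\to Y_i$ equals $K_i(X)\to X_i\xrightarrow{f_i}Y_i$ and $K_i(X)\xrightarrow{l}K_i(Y)\to H_i(Y)$ equals $K_i(X)\to H_i(X)\xrightarrow{\alpha_i}H_i(Y)$; likewise for $\beta_i$ with $g_i$. * $\delta_i$ is the connecting morphism: there are a kernel $\kappa\colon P\rightarrowtail Y_{i+1}$ of the composite $\bar Z_{i+1}\rightsquigarrow Z_{i+1}\rightsquigarrow Y_{i+1}$ and morphisms $p\colon P\to K_{i+1}(Z)$, $q\colon P\to K_i(X)$ such that $P\xrightarrow{p}K_{i+1}(Z)\to Z_{i+1}$ equals $P\xrightarrow{\kappa}Y_{i+1}\xrightarrow{g_{i+1}}Z_{i+1}$,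 such that $P\xrightarrow{q}K_i(X)\to X_i\xrightarrow{f_i}Y_i$ equals $P\xrightarrow{\kappa}Y_{i+1}\xrightarrow{d_{i+1}}Y_i$, and such that $P\xrightarrow{p}K_{i+1}(Z)\to H_{i+1}(Z)\xrightarrow{\delta_i}H_i(X)$ equals $P\xrightarrow{q}K_i(X)\to H_i(X)$. -/

import Mathlib

open CategoryTheory CategoryTheory.Limits

universe u v w

/-- The objects of a double category on `C`, regarded as the objects of its horizontal category. -/
@[ext] structure HorObj (C : Type u) where
  of : C

/-- The objects of a double category on `C`, regarded as the objects of its vertical category. -/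
@[ext] structure VerObj (C : Type u) where
  of : C

section Arrows

variable {C : Type u} [Category.{v} (HorObj C)] [Category.{w} (VerObj C)]

/-- Horizontal morphisms `A ↣ B`. -/
abbrev Hor (A B : C) : Type v := HorObj.mk A ⟶ HorObj.mk B

/-- Vertical morphisms `A ⤏ B`. -/
abbrev Ver (A B : C) : Type w := VerObj.mk A ⟶ VerObj.mk B

/-- Isomorphisms of the horizontal category. -/
abbrev HorIso (A B : C) : Type v := HorObj.mk A ≅ HorObj.mk B

/-- Isomorphisms of the vertical category. -/
abbrev VerIso (A B : C) : Type w := VerObj.mk A ≅ VerObj.mk B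

/-- The identity as a horizontal morphism. -/
abbrev hid (A : C) : Hor A A := 𝟙 (HorObj.mk A)

/-- The identity as a vertical morphism. -/
abbrev vid (A : C) : Ver A A := 𝟙 (VerObj.mk A)

end Arrows

/-- A double category with objects `C`, in which a boundary is filled by at most one square. The
proposition `Sq f a b g` says that
```
      f
  A  ↣  B
a ↓      ↓ b
  C  ↣  D
      g
```
is a (pseudo-commutative) square. In an ACGW category a square is automatically determined by its
boundary (the functor `c` below is faithful and vertical morphisms are monic), so nothing is lost
by treating squares as a property of the boundary. -/
class DoubleCategory (C : Type u) [Category.{v} (HorObj C)] [Category.{w} (VerObj C)] where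
  Sq : ∀ {A B A' B' : C}, Hor A B → Ver A A' → Ver B B' → Hor A' B' → Prop
  sq_hid : ∀ {A A' : C} (a : Ver A A'), Sq (hid A) a a (hid A')
  sq_vid : ∀ {A B : C} (f : Hor A B), Sq f (vid A) (vid B) f
  sq_hcomp : ∀ {A B D A' B' D' : C} {f : Hor A B} {g : Hor B D} {a : Ver A A'} {b : Ver B B'}
    {d : Ver D D'} {f' : Hor A' B'} {g' : Hor B' D'},
    Sq f a b f' → Sq g b d g' → Sq (f ≫ g) a d (f' ≫ g')
  sq_vcomp : ∀ {A B A' B' A'' B'' : C} {f : Hor A B} {f' : Hor A' B'} {f'' : Hor A'' B''}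
    {a : Ver A A'} {b : Ver B B'} {a' : Ver A' A''} {b' : Ver B' B''},
    Sq f a b f' → Sq f' a' b' f'' → Sq f (a ≫ a') (b ≫ b') f''

open DoubleCategory

/-- An ACGW category with objects `C`: a double category with
* an object `∅`, initial for the horizontal and for the vertical morphisms, all morphisms of both
  kinds being monic, and pullbacks within each kind;
* shared isomorphisms: an isomorphism `φ`, the identity on objects, between the groupoids of
  horizontal and of vertical isomorphisms, such that a boundary with two parallel sides
  invertible is a square exactly when it commutes after transport along `φ`;
* cokernels `c` of horizontal morphisms and kernels `k` of vertical ones, mutually inverse up to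
  isomorphism, and extending to equivalences
  `c : (horizontal arrows, squares) ≃ (vertical arrows, pullback squares)` and
  `k : (vertical arrows, squares) ≃ (horizontal arrows, pullback squares)`
  that keep the codomain; since all morphisms are monic the functor laws are automatic and
  what remains is stated as the duality between squares and pullbacks;
* every morphism and its complement meeting in `∅`. -/
class ACGWCategory (C : Type u) [Category.{v} (HorObj C)] [Category.{w} (VerObj C)] extends
    DoubleCategory C where
  /-- The object `∅`. -/
  zero : C
  horInitial : IsInitial (HorObj.mk zero)
  verInitial : IsInitial (VerObj.mk zero)
  hor_mono : ∀ {A B : C} (f : Hor A B), Mono f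
  ver_mono : ∀ {A B : C} (a : Ver A B), Mono a
  hor_pullbacks : HasPullbacks (HorObj C)
  ver_pullbacks : HasPullbacks (VerObj C)
  φ : ∀ {A B : C}, HorIso A B ≃ VerIso A B
  φ_refl : ∀ A : C, φ (Iso.refl (HorObj.mk A)) = Iso.refl (VerObj.mk A)
  φ_trans : ∀ {A B D : C} (f : HorIso A B) (g : HorIso B D), φ (f ≪≫ g) = φ f ≪≫ φ g
  sq_horIso : ∀ {A B A' B' : C} (f : HorIso A B) (a : Ver A A') (b : Ver B B') (g : HorIso A' B'),
    Sq f.hom a b g.hom ↔ (φ f).hom ≫ b = a ≫ (φ g).hom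
  sq_verIso : ∀ {A B A' B' : C} (f : Hor A B) (a : HorIso A A') (b : HorIso B B') (g : Hor A' B'),
    Sq f (φ a).hom (φ b).hom g ↔ f ≫ b.hom = a.hom ≫ g
  /-- The object `B ⫽ A` for `f : A ↣ B`. -/
  cObj : ∀ {A B : C}, Hor A B → C
  /-- The cokernel `B ⫽ A ⤏ B` of `f : A ↣ B`. -/
  c : ∀ {A B : C} (f : Hor A B), Ver (cObj f) B
  /-- The object `B ⑊ A` for `a : A ⤏ B`. -/
  kObj : ∀ {A B : C}, Ver A B → C
  /-- The kernel `B ⑊ A ↣ B` of `a : A ⤏ B`. -/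
  k : ∀ {A B : C} (a : Ver A B), Hor (kObj a) B
  c_k : ∀ {A B : C} (a : Ver A B), ∃ θ : VerIso A (cObj (k a)), θ.hom ≫ c (k a) = a
  k_c : ∀ {A B : C} (f : Hor A B), ∃ θ : HorIso A (kObj (c f)), θ.hom ≫ k (c f) = f
  /-- `c` takes squares to pullback squares. -/
  c_sq : ∀ {A B A' B' : C} {f : Hor A B} {a : Ver A A'} {b : Ver B B'} {g : Hor A' B'},
    Sq f a b g → ∃ t : Ver (cObj f) (cObj g), IsPullback t (c f) (c g) b
  /-- `c` is full and faithful. -/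
  c_ff : ∀ {A B A' B' : C} (f : Hor A B) (b : Ver B B') (g : Hor A' B')
    (t : Ver (cObj f) (cObj g)), IsPullback t (c f) (c g) b → ∃! a : Ver A A', Sq f a b g
  /-- `k` takes squares to pullback squares. -/
  k_sq : ∀ {A B A' B' : C} {f : Hor A B} {a : Ver A A'} {b : Ver B B'} {g : Hor A' B'},
    Sq f a b g → ∃ t : Hor (kObj a) (kObj b), IsPullback t (k a) (k b) g
  /-- `k` is full and faithful. -/
  k_ff : ∀ {A B A' B' : C} (a : Ver A A') (b : Ver B B') (g : Hor A' B')
    (t : Hor (kObj a) (kObj b)), IsPullback t (k a) (k b) g → ∃! f : Hor A B, Sq f a b g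
  c_disjoint : ∀ {A B : C} (f : Hor A B),
    Sq (horInitial.to (HorObj.mk (cObj f))) (verInitial.to (VerObj.mk A)) (c f) f
  k_disjoint : ∀ {A B : C} (a : Ver A B),
    Sq (horInitial.to (HorObj.mk A)) (verInitial.to (VerObj.mk (kObj a))) a (k a)

namespace ACGWCategory

variable {C : Type u} [Category.{v} (HorObj C)] [Category.{w} (VerObj C)] [ACGWCategory C]

/-- The morphism `∅ ↣ A`. -/
abbrev hzero (A : C) : Hor zero A := horInitial.to (HorObj.mk A)

/-- The morphism `∅ ⤏ A`. -/
abbrev vzero (A : C) : Ver zero A := verInitial.to (VerObj.mk A)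

/-- `A ↣ B ⤎ D` is a kernel-cokernel pair (a short exact sequence): the vertical morphism is
isomorphic to the cokernel of the horizontal one. -/
def IsComplement {A B D : C} (f : Hor A B) (e : Ver D B) : Prop :=
  ∃ θ : VerIso D (cObj f), θ.hom ≫ c f = e

/-- A diagram `A ⤎ mid ↣ B`. -/
structure Span (A B : C) where
  mid : C
  e : Ver mid A
  m : Hor mid B

/-- The spans `A ⤎ S ↣ B` and `A ⤎ T ↣ B` are isomorphic. -/
def Span.Isom {A B : C} (s t : Span A B) : Prop :=
  ∃ θ : HorIso s.mid t.mid, θ.hom ≫ t.m = s.m ∧ (φ θ).hom ≫ t.e = s.e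

theorem φ_symm {A B : C} (θ : HorIso A B) : φ θ.symm = (φ θ).symm := by
  have h : φ θ ≪≫ φ θ.symm = Iso.refl _ := by
    rw [← φ_trans, ← φ_refl]; simp
  ext
  have h' := congrArg Iso.hom h
  simp only [Iso.trans_hom, Iso.refl_hom] at h'
  rw [Iso.symm_hom, ← cancel_epi (φ θ).hom, h']
  simp

theorem Span.isom_equivalence (A B : C) : Equivalence (Span.Isom (A := A) (B := B)) where
  refl s := ⟨Iso.refl _, by simp, by simp [φ_refl]⟩
  symm := by
    rintro s t ⟨θ, h₁, h₂⟩
    exact ⟨θ.symm, by simp [← h₁], by simp [φ_symm, ← h₂]⟩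
  trans := by
    rintro s t r ⟨θ, h₁, h₂⟩ ⟨η, h₃, h₄⟩
    exact ⟨θ ≪≫ η, by simp [h₁, h₃], by simp [φ_trans, h₂, h₄]⟩

instance Span.setoid (A B : C) : Setoid (Span A B) := ⟨Span.Isom, Span.isom_equivalence A B⟩

/-- Every `A' ↣ B' ⤎ B` is completed to a square, with the object `A' ⊘ B` in the corner. -/
theorem exists_oslash {B A' B' : C} (g : Hor A' B') (b : Ver B B') :
    ∃ (T : C) (f : Hor T B) (a : Ver T A'), Sq f a b g := by
  have := ver_pullbacks (C := C)
  have hp := IsPullback.of_hasPullback (c g) b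
  obtain ⟨θ, hθ⟩ := c_k (A := (pullback (c g) b).of) (pullback.snd (c g) b)
  have hp' : IsPullback (θ.inv ≫ pullback.fst (c g) b)
      (c (k (A := (pullback (c g) b).of) (pullback.snd (c g) b))) (c g) b := by
    refine hp.of_iso θ (Iso.refl _) (Iso.refl _) (Iso.refl _) ?_ ?_ ?_ ?_ <;> simp [hθ]
  obtain ⟨a, ha, -⟩ := c_ff _ b g _ hp'
  exact ⟨_, _, a, ha⟩

theorem sq_left_unique {A B A' B' : C} {f : Hor A B} {a a' : Ver A A'} {b : Ver B B'}
    {g : Hor A' B'} (h : Sq f a b g) (h' : Sq f a' b g) : a = a' := by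
  obtain ⟨t, ht⟩ := c_sq h
  exact (c_ff f b g t ht).unique h h'

/-- Horizontal morphisms with isomorphic cokernels are isomorphic. -/
theorem exists_iso_of_c {A A' B : C} (f : Hor A B) (f' : Hor A' B)
    (z : VerIso (cObj f) (cObj f')) (hz : z.hom ≫ c f' = c f) :
    ∃ θ : HorIso A A', θ.hom ≫ f' = f ∧ Sq f (φ θ).hom (vid B) f' := by
  have hp : IsPullback z.hom (c f) (c f') (vid B) :=
    IsPullback.of_horiz_isIso ⟨by simp [hz]⟩
  have hp' : IsPullback z.inv (c f') (c f) (vid B) :=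
    IsPullback.of_horiz_isIso ⟨by simp [← hz]⟩
  obtain ⟨a, ha, -⟩ := c_ff _ _ _ _ hp
  obtain ⟨a', ha', -⟩ := c_ff _ _ _ _ hp'
  have h₁ : a ≫ a' = vid A := by
    have := sq_vcomp ha ha'
    rw [Category.comp_id] at this
    exact sq_left_unique this (sq_vid f)
  have h₂ : a' ≫ a = vid A' := by
    have := sq_vcomp ha' ha
    rw [Category.comp_id] at this
    exact sq_left_unique this (sq_vid f')
  let α : VerIso A A' := ⟨a, a', h₁, h₂⟩
  refine ⟨φ.symm α, ?_, ?_⟩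
  · have := (sq_verIso f (φ.symm α) (Iso.refl _) f').1
      (by rw [φ_refl, Equiv.apply_symm_apply]; exact ha)
    simpa using this.symm
  · rw [Equiv.apply_symm_apply]; exact ha

/-- The completion of `A' ↣ B' ⤎ B` to a square is unique up to isomorphism. -/
theorem oslash_unique {B A' B' T T' : C} {g : Hor A' B'} {b : Ver B B'} {f : Hor T B}
    {a : Ver T A'} {f' : Hor T' B} {a' : Ver T' A'} (h : Sq f a b g) (h' : Sq f' a' b g) :
    ∃ θ : HorIso T T', θ.hom ≫ f' = f ∧ (φ θ).hom ≫ a' = a := by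
  obtain ⟨t, ht⟩ := c_sq h
  obtain ⟨t', ht'⟩ := c_sq h'
  obtain ⟨θ, hθ, hs⟩ := exists_iso_of_c f f' (ht.isoIsPullback _ _ ht') (by simp)
  refine ⟨θ, hθ, ?_⟩
  have := sq_vcomp hs h'
  rw [Category.id_comp] at this
  exact sq_left_unique this h

/-- The composite `A ⤎ s.mid ⊘ t.mid ↣ D` of two spans. -/
noncomputable def Span.comp {A B D : C} (s : Span A B) (t : Span B D) : Span A D where
  mid := (exists_oslash s.m t.e).choose
  e := (exists_oslash s.m t.e).choose_spec.choose_spec.choose ≫ s.e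
  m := (exists_oslash s.m t.e).choose_spec.choose ≫ t.m

/-- Every square over `s.m` and `t.e` computes the composite, up to isomorphism. -/
theorem Span.comp_isom {A B D T : C} {s s' : Span A B} {t t' : Span B D} (hs : Isom s s')
    (ht : Isom t t') {f : Hor T t.mid} {a : Ver T s.mid} (h : Sq f a t.e s.m) :
    Isom ⟨T, a ≫ s.e, f ≫ t.m⟩ (s'.comp t') := by
  obtain ⟨θ, h₁, h₂⟩ := hs
  obtain ⟨η, h₃, h₄⟩ := ht
  have q₁ : Sq η.hom t.e t'.e (hid B) :=
    (sq_horIso η t.e t'.e (Iso.refl _)).2 (by simp [φ_refl, h₄])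
  have q₂ : Sq s.m (φ θ).hom (vid B) s'.m := by
    have := (sq_verIso s.m θ (Iso.refl _) s'.m).2 (by simp [h₁])
    rwa [φ_refl] at this
  have q₃ : Sq (f ≫ η.hom) (a ≫ (φ θ).hom) t'.e s'.m := by
    have := sq_hcomp h q₁
    rw [Category.comp_id] at this
    have := sq_vcomp this q₂
    rwa [Category.comp_id] at this
  obtain ⟨ζ, h₅, h₆⟩ := oslash_unique q₃
    (exists_oslash s'.m t'.e).choose_spec.choose_spec.choose_spec
  refine ⟨ζ, ?_, ?_⟩
  · refine (Category.assoc _ _ _).symm.trans ((congrArg (· ≫ t'.m) h₅).trans ?_)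
    rw [Category.assoc, h₃]
  · refine (Category.assoc _ _ _).symm.trans ((congrArg (· ≫ s'.e) h₆).trans ?_)
    rw [Category.assoc, h₂]

variable (C) in
/-- The objects of the flattening `𝔸^♭`. -/
structure Flat where
  of : C

/-- Composition of isomorphism classes of spans. -/
noncomputable def flatComp {A B D : C} :
    Quotient (Span.setoid A B) → Quotient (Span.setoid B D) → Quotient (Span.setoid A D) :=
  Quotient.map₂ Span.comp (fun s _ hs t _ ht => Span.comp_isom hs ht
    (exists_oslash s.m t.e).choose_spec.choose_spec.choose_spec)

theorem flatComp_mk {A B D T : C} {s : Span A B} {t : Span B D} {f : Hor T t.mid}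
    {a : Ver T s.mid} (h : Sq f a t.e s.m) :
    flatComp (Quotient.mk _ s) (Quotient.mk _ t) =
      Quotient.mk _ (⟨T, a ≫ s.e, f ≫ t.m⟩ : Span A D) :=
  (Quotient.sound (Span.comp_isom ((Span.isom_equivalence _ _).refl _)
    ((Span.isom_equivalence _ _).refl _) h)).symm

/-- The flattening `𝔸^♭`: morphisms are isomorphism classes of spans `A ⤎ Ā ↣ B`, composed by
means of `⊘`. -/
noncomputable instance : Category (Flat C) where
  Hom A B := Quotient (Span.setoid A.of B.of)
  id A := Quotient.mk _ ⟨A.of, vid _, hid _⟩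
  comp f g := flatComp f g
  id_comp := by
    rintro A B ⟨s⟩
    refine (flatComp_mk (s := ⟨A.of, vid _, hid _⟩) (t := s) (sq_hid s.e)).trans ?_
    simp only [Category.comp_id, Category.id_comp]
    rfl
  comp_id := by
    rintro A B ⟨s⟩
    refine (flatComp_mk (s := s) (t := ⟨B.of, vid _, hid _⟩) (sq_vid s.m)).trans ?_
    simp only [Category.comp_id, Category.id_comp]
    rfl
  assoc := by
    rintro A B D E ⟨s⟩ ⟨t⟩ ⟨r⟩
    obtain ⟨T₁, f₁, a₁, h₁⟩ := exists_oslash s.m t.e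
    obtain ⟨T₂, f₂, a₂, h₂⟩ := exists_oslash t.m r.e
    obtain ⟨T₃, f₃, a₃, h₃⟩ := exists_oslash f₁ a₂
    have e₁ := flatComp_mk (s := s) (t := t) h₁
    have e₂ := flatComp_mk (s := t) (t := r) h₂
    have e₃ := flatComp_mk (s := ⟨T₁, a₁ ≫ s.e, f₁ ≫ t.m⟩) (t := r) (sq_hcomp h₃ h₂)
    have e₄ := flatComp_mk (s := s) (t := ⟨T₂, a₂ ≫ t.e, f₂ ≫ r.m⟩) (sq_vcomp h₃ h₁)
    change flatComp (flatComp (Quotient.mk _ s) (Quotient.mk _ t)) (Quotient.mk _ r) =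
      flatComp (Quotient.mk _ s) (flatComp (Quotient.mk _ t) (Quotient.mk _ r))
    rw [e₁, e₂, e₃, e₄]
    simp only [Category.assoc]

/-- The class of a span as a morphism of `𝔸^♭`. -/
def Span.flat {A B : C} (s : Span A B) : Flat.mk A ⟶ Flat.mk B := Quotient.mk _ s

/-- The morphism `A ⤎ A ↣ B` of `𝔸^♭` given by a horizontal morphism `A ↣ B`. -/
def flatHor {A B : C} (f : Hor A B) : Flat.mk A ⟶ Flat.mk B := Span.flat ⟨A, vid A, f⟩

/-- The morphism `B ⤎ A ↣ A` of `𝔸^♭` given by a vertical morphism `A ⤏ B`. -/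
def flatVer {A B : C} (a : Ver A B) : Flat.mk B ⟶ Flat.mk A := Span.flat ⟨A, a, hid A⟩

/-- The homology of `A ↣ X ⤎ D`, by taking complements in both directions:
```
            H
          ⤎   ↣
        Z       Q
      ↣   ↣   ⤎   ⤎
    A       X       D
```
Here `ι : Z ↣ X` is the kernel of `e : D ⤏ X`, `ρ : Q ⤏ X` is the cokernel of `m : A ↣ X`,
`π : H ⤏ Z` is the cokernel of the induced `A ↣ Z`, `j : H ↣ Q` is the kernel of the induced
`D ⤏ Q`, and the middle is a pseudo-commutative square. -/
structure HomologyData {A X D : C} (m : Hor A X) (e : Ver D X) where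
  Z : C
  Q : C
  H : C
  ι : Hor Z X
  ρ : Ver Q X
  isKernel : IsComplement ι e
  isCokernel : IsComplement m ρ
  b : Hor A Z
  b_ι : b ≫ ι = m
  t : Ver D Q
  t_ρ : t ≫ ρ = e
  π : Ver H Z
  j : Hor H Q
  isComplement_π : IsComplement b π
  isComplement_j : IsComplement j t
  sq : Sq j π ρ ι

theorem exists_c_iso {A A' B : C} {f : Hor A B} {f' : Hor A' B} (θ : HorIso A A')
    (h : θ.hom ≫ f' = f) : ∃ z : VerIso (cObj f) (cObj f'), z.hom ≫ c f' = c f := by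
  have hs : Sq f (φ θ).hom (vid B) f' := by
    have := (sq_verIso f θ (Iso.refl _) f').2 (by simp [h])
    rwa [φ_refl] at this
  obtain ⟨t, ht⟩ := c_sq hs
  have : IsIso t := ht.isIso_fst_of_isIso
  exact ⟨asIso t, by simpa using ht.w⟩

/-- The kernel of `∅ ⤏ A` is the identity. -/
theorem exists_k_vzero (A : C) : ∃ θ : HorIso A (kObj (vzero A)), θ.hom ≫ k (vzero A) = hid A := by
  obtain ⟨θ, -, -⟩ := oslash_unique (c_disjoint (hid A)) (sq_hid (c (hid A)))
  obtain ⟨η, hη⟩ := c_k (vzero A)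
  obtain ⟨ζ, hζ, -⟩ := exists_iso_of_c (hid A) (k (vzero A)) ((φ θ).symm ≪≫ η) (by
    rw [← cancel_epi (φ θ).hom]
    exact verInitial.hom_ext _ _)
  exact ⟨ζ, hζ⟩

/-- The cokernel of `∅ ↣ A` is the identity. -/
theorem exists_c_hzero (A : C) : ∃ θ : VerIso A (cObj (hzero A)), θ.hom ≫ c (hzero A) = vid A := by
  obtain ⟨θ, -, -⟩ := oslash_unique (k_disjoint (vid A)) (sq_vid (k (vid A)))
  obtain ⟨η, hη⟩ := c_k (vid A)
  obtain ⟨z, hz⟩ := exists_c_iso (f := hzero A) θ (horInitial.hom_ext _ _)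
  exact ⟨η ≪≫ z.symm, by simp [← hz, hη]⟩

/-- The homology exists at every position where the chain condition holds. -/
theorem exists_homologyData {A X D : C} (m : Hor A X) (e : Ver D X)
    (h : Sq (hzero D) (vzero A) e m) : Nonempty (HomologyData m e) := by
  obtain ⟨H, j, π, sq⟩ := exists_oslash (k e) (c m)
  obtain ⟨b₀, hb₀⟩ := k_sq h
  obtain ⟨θ, hθ⟩ := exists_k_vzero A
  obtain ⟨t₀, ht₀⟩ := c_sq h
  obtain ⟨θ', hθ'⟩ := exists_c_hzero D
  obtain ⟨η, hη⟩ := k_c m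
  obtain ⟨η', hη'⟩ := c_k e
  have hη₂ : η.inv ≫ m = k (c m) := (Iso.inv_comp_eq _).2 hη.symm
  have hη₃ : η'.inv ≫ e = c (k e) := (Iso.inv_comp_eq _).2 hη'.symm
  have hb : (θ.hom ≫ b₀) ≫ k e = m := by
    rw [Category.assoc, hb₀.w, ← Category.assoc, hθ, Category.id_comp]
  have ht : (θ'.hom ≫ t₀) ≫ c m = e := by
    rw [Category.assoc, ht₀.w, ← Category.assoc, hθ', Category.id_comp]
  refine ⟨⟨_, _, H, k e, c m, c_k e, ⟨Iso.refl _, by simp⟩, θ.hom ≫ b₀, hb, θ'.hom ≫ t₀, ht, π, j,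
    ?_, ?_, sq⟩⟩
  · obtain ⟨s, hs⟩ := k_sq sq
    have := hor_mono (k e)
    have := hor_mono (k π)
    let ζ : HorIso A (kObj π) :=
      { hom := hs.lift η.hom (θ.hom ≫ b₀) (by rw [hη, hb])
        inv := s ≫ η.inv
        hom_inv_id := by simp
        inv_hom_id := by
          rw [← cancel_mono (k π), ← cancel_mono (k e)]
          simp only [Category.assoc, IsPullback.lift_snd, Category.id_comp]
          rw [← Category.assoc θ.hom, hb, ← hs.w, hη₂] }
    obtain ⟨z, hz⟩ := exists_c_iso (f := θ.hom ≫ b₀) (f' := k π) ζ (by simp [ζ])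
    obtain ⟨y, hy⟩ := c_k π
    exact ⟨y ≪≫ z.symm, by simp [← hz, hy]⟩
  · obtain ⟨s, hs⟩ := c_sq sq
    have := ver_mono (c m)
    have := ver_mono (c j)
    let ζ : VerIso D (cObj j) :=
      { hom := hs.lift η'.hom (θ'.hom ≫ t₀) (by rw [hη', ht])
        inv := s ≫ η'.inv
        hom_inv_id := by simp
        inv_hom_id := by
          rw [← cancel_mono (c j), ← cancel_mono (c m)]
          simp only [Category.assoc, IsPullback.lift_snd, Category.id_comp]
          rw [← Category.assoc θ'.hom, ht, ← hs.w, hη₃] }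
    exact ⟨ζ, by simp [ζ]⟩

end ACGWCategory

open ACGWCategory

/-- A sequence of spans `⋯ X (s i) ⤎ X̄ (s i) ↣ X i ⤎ X̄ i ↣ ⋯`, with an index set `I` and the
function `s` taking each index to the preceding position of the sequence. The usual indexing is
`I = ℤ`, `s i = i + 1`. -/
structure SpanSequence (C : Type u) [Category.{v} (HorObj C)] [Category.{w} (VerObj C)]
    [ACGWCategory C] {I : Type} (s : I → I) where
  X : I → C
  bar : I → C
  e : ∀ i, Ver (bar i) (X i)
  m : ∀ i, Hor (bar (s i)) (X i)

namespace SpanSequence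

variable {C : Type u} [Category.{v} (HorObj C)] [Category.{w} (VerObj C)] [ACGWCategory C]
  {I : Type} {s : I → I}

/-- The differential `X (s i) ⤎ X̄ (s i) ↣ X i`. -/
def d (X : SpanSequence C s) (i : I) : Span (X.X (s i)) (X.X i) := ⟨X.bar (s i), X.e (s i), X.m i⟩

/-- Consecutive differentials compose to zero. -/
def IsComplex (X : SpanSequence C s) : Prop :=
  ∀ i, Sq (hzero (X.bar i)) (vzero (X.bar (s i))) (X.e i) (X.m i)

/-- A chain complex whose homology is `∅` everywhere. -/
def IsExact (X : SpanSequence C s) : Prop :=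
  X.IsComplex ∧ ∀ i, ∃ h : HomologyData (X.m i) (X.e i), Nonempty (HorIso h.H zero)

end SpanSequence

/-- A chain complex `⋯ X (i + 1) ⤎ X̄ (i + 1) ↣ X i ⤎ X̄ i ↣ X (i - 1) ⋯`, `i ∈ ℤ`. -/
structure ACGWChainComplex (C : Type u) [Category.{v} (HorObj C)] [Category.{w} (VerObj C)]
    [ACGWCategory C] extends SpanSequence C (fun i : ℤ => i + 1) where
  isComplex : toSpanSequence.IsComplex

namespace ACGWChainComplex

variable {C : Type u} [Category.{v} (HorObj C)] [Category.{w} (VerObj C)] [ACGWCategory C]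

/-- The homology of a chain complex in degree `i`; `h.H` is the object `H i X`, and `h.Z` is the
kernel `X i ⑊ X̄ i` of the differential. -/
abbrev Homology (X : ACGWChainComplex C) (i : ℤ) := HomologyData (X.m i) (X.e i)

/-- A horizontal morphism of chain complexes. -/
structure HorHom (X Y : ACGWChainComplex C) where
  f : ∀ i, Hor (X.X i) (Y.X i)
  bar : ∀ i, Hor (X.bar i) (Y.bar i)
  sq : ∀ i, Sq (bar i) (X.e i) (Y.e i) (f i)
  comm : ∀ i, X.m i ≫ f i = bar (i + 1) ≫ Y.m i

/-- A vertical morphism of chain complexes. -/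
structure VerHom (Z Y : ACGWChainComplex C) where
  g : ∀ i, Ver (Z.X i) (Y.X i)
  bar : ∀ i, Ver (Z.bar i) (Y.bar i)
  comm : ∀ i, Z.e i ≫ g i = bar i ≫ Y.e i
  sq : ∀ i, Sq (Z.m i) (bar (i + 1)) (g i) (Y.m i)

/-- `X ↣ Y ⤎ Z` is a short exact sequence of chain complexes, complements of morphisms of chain
complexes being the complements in each degree. (Given `X ↣ Y` and the objects `Z i`, the
objects `Z̄ i` and the structure morphisms of `Z` are forced, up to isomorphism, by the
conditions in `VerHom`; similarly for `X`.) -/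
def IsShortExact {X Y Z : ACGWChainComplex C} (f : HorHom X Y) (g : VerHom Z Y) : Prop :=
  ∀ i, IsComplement (f.f i) (g.g i)

/-- The morphism `p : X i ⟶ Y i` of `𝔸^♭` induces `α : H i X ⟶ H i Y`: it restricts to a morphism
between the kernels of the differentials, and `α` is obtained from that by passing to the
quotients. -/
def Induces {X Y : ACGWChainComplex C} {i : ℤ} (hX : X.Homology i) (hY : Y.Homology i)
    (p : Flat.mk (X.X i) ⟶ Flat.mk (Y.X i)) (α : Flat.mk hX.H ⟶ Flat.mk hY.H) : Prop :=
  ∃ l : Flat.mk hX.Z ⟶ Flat.mk hY.Z,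
    l ≫ flatHor hY.ι = flatHor hX.ι ≫ p ∧ l ≫ flatVer hY.π = flatVer hX.π ≫ α

/-- The usual construction of the connecting morphism, in `𝔸^♭`. Let `κ : P ↣ Y (i + 1)` be the
kernel of `Y (i + 1) ⟶ Y i ⟶ Z i`, that is, of `Z̄ (i + 1) ⤏ Y (i + 1)`. The projection
`Y (i + 1) ⟶ Z (i + 1)` restricts to `p` from `P` to the kernel of the differential of `Z`, the
differential of `Y` restricts to `q` from `P` to the kernel of the differential of `X`, and
`δ` sends the class of `p` to the class of `q`. -/
def IsConnecting {X Y Z : ACGWChainComplex C} (f : HorHom X Y) (g : VerHom Z Y) {i : ℤ}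
    (hZ : Z.Homology (i + 1)) (hX : X.Homology i) (δ : Flat.mk hZ.H ⟶ Flat.mk hX.H) : Prop :=
  ∃ (P : C) (κ : Hor P (Y.X (i + 1))) (p : Flat.mk P ⟶ Flat.mk hZ.Z)
    (q : Flat.mk P ⟶ Flat.mk hX.Z),
    IsComplement κ (Z.e (i + 1) ≫ g.g (i + 1)) ∧
    p ≫ flatHor hZ.ι = flatHor κ ≫ flatVer (g.g (i + 1)) ∧
    q ≫ flatHor hX.ι ≫ flatHor (f.f i) = flatHor κ ≫ (Y.d i).flat ∧
    p ≫ flatVer hZ.π ≫ δ = q ≫ flatVer hX.π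

/-- Positions of the long exact sequence: `x i`, `y i`, `z i` are the places of `H i X`,
`H i Y`, `H (i + 1) Z`. -/
inductive LESIndex : Type
  | x (i : ℤ)
  | y (i : ℤ)
  | z (i : ℤ)

/-- The position preceding a given one, in the order
`⋯, H (i + 1) Y, H (i + 1) Z, H i X, H i Y, H i Z, H (i - 1) X, ⋯`. -/
def LESIndex.prev : LESIndex → LESIndex
  | x i => z i
  | y i => x i
  | z i => y (i + 1)

/-- The sequence `⋯ H (i + 1) Z ⟶ H i X ⟶ H i Y ⟶ H i Z ⟶ ⋯` with differentials the spans
`δ i`, `α i`, `β i`. -/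
def longSequence {X Y Z : ACGWChainComplex C} {hX : ∀ i, X.Homology i} {hY : ∀ i, Y.Homology i}
    {hZ : ∀ i, Z.Homology i} (α : ∀ i, Span (hX i).H (hY i).H) (β : ∀ i, Span (hY i).H (hZ i).H)
    (δ : ∀ i, Span (hZ (i + 1)).H (hX i).H) : SpanSequence C LESIndex.prev where
  X
    | .x i => (hX i).H
    | .y i => (hY i).H
    | .z i => (hZ (i + 1)).H
  bar
    | .x i => (α i).mid
    | .y i => (β i).mid
    | .z i => (δ i).mid
  e
    | .x i => (α i).e
    | .y i => (β i).e
    | .z i => (δ i).e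
  m
    | .x i => (δ i).m
    | .y i => (α i).m
    | .z i => (β (i + 1)).m

end ACGWChainComplex

open ACGWChainComplex

/-!
The flattening of an ACGW category is a Puppe-exact category: it has zero morphisms, kernels and
cokernels, and every morphism is a normal epimorphism followed by a normal monomorphism. Indeed a
span `A ⤎ S ↣ B` is the composite of the epimorphism `A ⟶ S` given by its vertical leg and the
monomorphism `S ⟶ B` given by its horizontal leg, and a complementary pair `A ↣ B ⤎ D` becomes a
kernel-cokernel pair `A ⟶ B ⟶ D`, by the duality between squares and pullbacks. Squares become
commutative squares, so complexes, their homology and short exact sequences become the usual ones.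

The long exact sequence holds in every Puppe-exact category; neither addition nor products are
needed. Elements are replaced by subobjects, moved by direct images `dir f` and inverse images
`pre f`. These are adjoint (`PuppeExact.dir_le`) and satisfy a modular law: `pre f (dir f x) = x`
if `x` contains the kernel of `f` (`PuppeExact.pre_dir`), and `dir f (pre f y) = y` if `y` is
contained in the image of `f` (`PuppeExact.dir_pre`). The usual diagram chase for the existence of
the connecting morphism and for exactness at the three kinds of positions then becomes a chain of
inclusions (`ConnectingData.exists_desc`, `exact_middle`, `ConnectingData.exact_right`,
`ConnectingData.exact_left` in the namespace `PuppeExact.FactoredComplex`).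

Finally, exactness at a position of a sequence of spans in the flattening says that the horizontal
leg of the incoming span and the vertical leg of the outgoing one are complementary
(`ACGWCategory.isComplement_of_exact`), and the homology of a complementary pair is `∅`.
-/

/-! ### Puppe-exact categories -/

/-- A Puppe-exact category: a category with zero morphisms, kernels and cokernels in which every
morphism is a normal epimorphism followed by a normal monomorphism. No additivity is required. -/
class PuppeExact (E : Type u) [Category.{v} E] [HasZeroMorphisms E] : Prop where
  hasKernels : HasKernels E
  hasCokernels : HasCokernels E
  exists_fac : ∀ {A B : E} (f : A ⟶ B), ∃ (I : E) (p : A ⟶ I) (i : I ⟶ B),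
    p ≫ i = f ∧ Nonempty (NormalEpi p) ∧ Nonempty (NormalMono i)

namespace PuppeExact

attribute [instance] hasKernels hasCokernels

variable {E : Type u} [Category.{v} E]

theorem le_iff_factors {A : E} {x y : Subobject A} : x ≤ y ↔ y.Factors x.arrow :=
  ⟨fun h => Subobject.ofLE_arrow h ▸ Subobject.factors_comp_arrow _,
   fun h => Subobject.le_of_comm (y.factorThru _ h) (by simp)⟩

theorem mk_factors {A B T : E} (i : A ⟶ B) [Mono i] (t : T ⟶ B) :
    (Subobject.mk i).Factors t ↔ ∃ s : T ⟶ A, s ≫ i = t :=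
  Subobject.mk_factors_iff i t

variable [HasZeroMorphisms E] [PuppeExact E]

theorem exists_epi_mono_fac {A B : E} (f : A ⟶ B) :
    ∃ (I : E) (p : A ⟶ I) (i : I ⟶ B), p ≫ i = f ∧ Epi p ∧ Mono i := by
  obtain ⟨I, p, i, h, ⟨hp⟩, ⟨hi⟩⟩ := exists_fac f
  exact ⟨I, p, i, h, inferInstance, inferInstance⟩

/-- Every monomorphism is the kernel of its cokernel. -/
theorem exists_lift_of_mono {A B T : E} (f : A ⟶ B) [Mono f] (t : T ⟶ B)
    (ht : t ≫ cokernel.π f = 0) : ∃ s, s ≫ f = t := by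
  obtain ⟨I, p, i, rfl, ⟨hp⟩, ⟨hi⟩⟩ := exists_fac f
  have : Epi p := inferInstance
  -- the normal epimorphism `p` is the cokernel of `hp.g`, which is `0` because `p ≫ i` is monic
  have hw : hp.g = 0 := by
    rw [← cancel_mono (p ≫ i), ← Category.assoc, hp.w, zero_comp, zero_comp]
  obtain ⟨r, hr⟩ : ∃ r : I ⟶ A, p ≫ r = 𝟙 A :=
    (CokernelCofork.IsColimit.desc' hp.isColimit (𝟙 A) (by simp [hw])).exists_of_subtype
  have hr' : r ≫ p = 𝟙 I := by
    rw [← cancel_epi p, ← Category.assoc, hr, Category.id_comp, Category.comp_id]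
  have hz : t ≫ hi.g = 0 := by
    have : (p ≫ i) ≫ hi.g = 0 := by rw [Category.assoc, hi.w, comp_zero]
    rw [← cokernel.π_desc (p ≫ i) hi.g this, ← Category.assoc, ht, zero_comp]
  obtain ⟨s, hs⟩ : ∃ s : T ⟶ I, s ≫ i = t :=
    (KernelFork.IsLimit.lift' hi.isLimit t hz).exists_of_subtype
  exact ⟨s ≫ r, by rw [Category.assoc, ← Category.assoc r, hr', Category.id_comp, hs]⟩

/-- Every epimorphism is the cokernel of its kernel. -/
theorem exists_desc_of_epi {A B T : E} (f : A ⟶ B) [Epi f] (t : A ⟶ T)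
    (ht : kernel.ι f ≫ t = 0) : ∃ s, f ≫ s = t := by
  obtain ⟨I, p, i, rfl, ⟨hp⟩, ⟨hi⟩⟩ := exists_fac f
  have : Mono i := inferInstance
  have hw : hi.g = 0 := by
    rw [← cancel_epi (p ≫ i), Category.assoc, hi.w, comp_zero, comp_zero]
  obtain ⟨r, hr⟩ : ∃ r : B ⟶ I, r ≫ i = 𝟙 B :=
    (KernelFork.IsLimit.lift' hi.isLimit (𝟙 B) (by simp [hw])).exists_of_subtype
  have hr' : i ≫ r = 𝟙 I := by
    rw [← cancel_mono i, Category.assoc, hr, Category.id_comp, Category.comp_id]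
  have hz : hp.g ≫ t = 0 := by
    have : hp.g ≫ p ≫ i = 0 := by rw [← Category.assoc, hp.w, zero_comp]
    rw [← kernel.lift_ι (p ≫ i) hp.g this, Category.assoc, ht, comp_zero]
  obtain ⟨s, hs⟩ : ∃ s : I ⟶ T, p ≫ s = t :=
    (CokernelCofork.IsColimit.desc' hp.isColimit t hz).exists_of_subtype
  exact ⟨r ≫ s, by rw [Category.assoc, ← Category.assoc i, hr', Category.id_comp, hs]⟩

/-! ### Direct and inverse images of subobjects -/

/-- The kernel of a morphism, as a subobject. -/
noncomputable abbrev ker {A B : E} (f : A ⟶ B) : Subobject A := kernelSubobject f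

/-- The image of a morphism, as a subobject: the kernel of the cokernel. -/
noncomputable def im {A B : E} (f : A ⟶ B) : Subobject B := ker (cokernel.π f)

/-- The direct image of a subobject. -/
noncomputable def dir {A B : E} (f : A ⟶ B) (x : Subobject A) : Subobject B := im (x.arrow ≫ f)

/-- The inverse image of a subobject, as the kernel of the composite with the quotient by it. -/
noncomputable def pre {A B : E} (f : A ⟶ B) (y : Subobject B) : Subobject A :=
  ker (f ≫ cokernel.π y.arrow)

theorem factors_iff {A T : E} (y : Subobject A) (t : T ⟶ A) :
    y.Factors t ↔ t ≫ cokernel.π y.arrow = 0 := by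
  constructor
  · intro h
    rw [← y.factorThru_arrow t h, Category.assoc, cokernel.condition, comp_zero]
  · intro h
    obtain ⟨s, hs⟩ := exists_lift_of_mono y.arrow t h
    exact hs ▸ Subobject.factors_comp_arrow s

theorem ker_factors {A B T : E} {f : A ⟶ B} {t : T ⟶ A} : (ker f).Factors t ↔ t ≫ f = 0 :=
  kernelSubobject_factors_iff _ _

theorem le_ker {A B : E} {f : A ⟶ B} {x : Subobject A} : x ≤ ker f ↔ x.arrow ≫ f = 0 := by
  rw [le_iff_factors, ker_factors]

theorem ker_le {A B : E} {f : A ⟶ B} {x : Subobject A} :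
    ker f ≤ x ↔ ∀ (T : E) (t : T ⟶ A), t ≫ f = 0 → x.Factors t :=
  ⟨fun h _ _ ht => Subobject.factors_of_le _ h (ker_factors.2 ht),
   fun h => le_iff_factors.2 (h _ _ (le_ker.1 le_rfl))⟩

theorem pre_factors {A B T : E} {f : A ⟶ B} {y : Subobject B} {t : T ⟶ A} :
    (pre f y).Factors t ↔ y.Factors (t ≫ f) := by
  rw [pre, ker_factors, factors_iff, Category.assoc]

theorem im_le {A B : E} {f : A ⟶ B} {y : Subobject B} : im f ≤ y ↔ y.Factors f := by
  constructor
  · intro h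
    exact Subobject.factors_of_le f h (ker_factors.2 (cokernel.condition f))
  · intro h
    have hf := (factors_iff y f).1 h
    refine ker_le.2 fun T t ht => (factors_iff y t).2 ?_
    rw [← cokernel.π_desc f _ hf, ← Category.assoc, ht, zero_comp]

theorem im_factors {A B : E} (f : A ⟶ B) : (im f).Factors f := im_le.1 le_rfl

/-- Direct image is left adjoint to inverse image. -/
theorem dir_le {A B : E} {f : A ⟶ B} {x : Subobject A} {y : Subobject B} :
    dir f x ≤ y ↔ x ≤ pre f y := by
  rw [dir, im_le, le_iff_factors, pre_factors]

theorem dir_mono {A B : E} (f : A ⟶ B) {x x' : Subobject A} (h : x ≤ x') : dir f x ≤ dir f x' :=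
  dir_le.2 (h.trans (dir_le.1 le_rfl))

theorem pre_mono {A B : E} (f : A ⟶ B) {y y' : Subobject B} (h : y ≤ y') : pre f y ≤ pre f y' :=
  dir_le.1 ((dir_le.2 le_rfl).trans h)

theorem dir_le_im {A B : E} (f : A ⟶ B) (x : Subobject A) : dir f x ≤ im f :=
  im_le.2 (Subobject.factors_of_factors_right x.arrow (im_factors f))

theorem ker_le_pre {A B : E} (f : A ⟶ B) (y : Subobject B) : ker f ≤ pre f y :=
  ker_le.2 fun _ _ ht => pre_factors.2 (by rw [ht]; exact Subobject.factors_zero)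

theorem dir_im {A B D : E} (f : A ⟶ B) (g : B ⟶ D) : dir g (im f) = im (f ≫ g) :=
  eq_of_forall_ge_iff fun y => by rw [dir_le, im_le, im_le, pre_factors]

theorem dir_comp {A B D : E} (f : A ⟶ B) (g : B ⟶ D) (x : Subobject A) :
    dir (f ≫ g) x = dir g (dir f x) := by
  rw [dir, ← Category.assoc, ← dir_im, ← dir]

theorem pre_ker {A B D : E} (f : A ⟶ B) (g : B ⟶ D) : pre f (ker g) = ker (f ≫ g) :=
  le_antisymm
    (le_ker.2 (by
      rw [← Category.assoc]; exact ker_factors.1 (pre_factors.1 (le_iff_factors.1 le_rfl))))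
    (ker_le.2 fun T t ht => pre_factors.2 (ker_factors.2 (by rwa [Category.assoc])))

theorem ker_comp_mono {A B D : E} (f : A ⟶ B) (g : B ⟶ D) [Mono g] : ker (f ≫ g) = ker f :=
  kernelSubobject_comp_mono f g

theorem im_epi_comp {A B D : E} (f : A ⟶ B) (g : B ⟶ D) [Epi f] : im (f ≫ g) = im g :=
  le_antisymm (im_le.2 (Subobject.factors_of_factors_right f (im_factors g)))
    (im_le.2 ((factors_iff _ _).2 (by
      rw [← cancel_epi f, ← Category.assoc, comp_zero]
      exact (factors_iff _ _).1 (im_factors _))))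

theorem pre_dir_of_mono {A B : E} (f : A ⟶ B) [Mono f] (x : Subobject A) :
    pre f (dir f x) = x := by
  refine le_antisymm (le_iff_factors.2 ?_) (dir_le.1 le_rfl)
  have h : dir f x ≤ Subobject.mk (x.arrow ≫ f) := im_le.2 ((mk_factors _ _).2 ⟨𝟙 _, by simp⟩)
  obtain ⟨z, hz⟩ := (mk_factors _ _).1
    (Subobject.factors_of_le _ h (pre_factors.1 (le_iff_factors.1 le_rfl)))
  rw [← Category.assoc, cancel_mono] at hz
  exact hz ▸ Subobject.factors_comp_arrow z

theorem le_of_dir_le {A B : E} (f : A ⟶ B) [Mono f] {x x' : Subobject A}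
    (h : dir f x ≤ dir f x') : x ≤ x' :=
  (dir_le.1 h).trans (pre_dir_of_mono f x').le

theorem exists_desc {A B T : E} (f : A ⟶ B) [Epi f] (t : A ⟶ T) (h : ker f ≤ ker t) :
    ∃ s, f ≫ s = t :=
  exists_desc_of_epi f t (ker_factors.1 (Subobject.factors_of_le _ h
    (ker_factors.2 (kernel.condition f))))

theorem dir_pre_of_epi {A B : E} (e : A ⟶ B) [Epi e] (y : Subobject B) : dir e (pre e y) = y := by
  refine le_antisymm (dir_le.2 le_rfl) ?_
  -- the quotient by `dir e (pre e y)` factors through the quotient by `y`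
  obtain ⟨s, hs⟩ := exists_desc (e ≫ cokernel.π y.arrow)
    (e ≫ cokernel.π (dir e (pre e y)).arrow) (dir_le.1 le_rfl)
  rw [Category.assoc, cancel_epi] at hs
  rw [le_iff_factors, factors_iff, ← hs, ← Category.assoc, cokernel.condition, zero_comp]

/-- A subobject contained in the image is the direct image of its inverse image. -/
theorem dir_pre {A B : E} (f : A ⟶ B) {y : Subobject B} (h : y ≤ im f) : dir f (pre f y) = y := by
  refine le_antisymm (dir_le.2 le_rfl) ?_
  obtain ⟨I, p, i, rfl, hp, hi⟩ := exists_epi_mono_fac f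
  rw [im_epi_comp] at h
  have h' := h.trans (im_le.2 ((mk_factors i i).2 ⟨𝟙 _, by simp⟩))
  obtain ⟨z, hz⟩ := (mk_factors _ _).1 (le_iff_factors.1 h')
  have h₁ : y ≤ dir i (im z) := by
    rw [dir_im, hz, le_iff_factors]
    exact im_factors _
  have h₂ : im z ≤ pre i y := im_le.2 (pre_factors.2 (hz ▸ le_iff_factors.1 le_rfl))
  refine h₁.trans ?_
  rw [dir_comp, ← dir_pre_of_epi p (im z)]
  refine dir_mono _ (dir_mono _ ?_)
  rw [← dir_le, dir_comp, dir_pre_of_epi p, dir_le]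
  exact h₂

/-- A subobject containing the kernel is the inverse image of its direct image. -/
theorem pre_dir {A B : E} (f : A ⟶ B) {x : Subobject A} (h : ker f ≤ x) : pre f (dir f x) = x := by
  refine le_antisymm ?_ (dir_le.1 le_rfl)
  obtain ⟨I, e, i, rfl, he, hi⟩ := exists_epi_mono_fac f
  rw [ker_comp_mono] at h
  have hx : ker e ≤ ker (cokernel.π x.arrow) :=
    h.trans (le_ker.2 (cokernel.condition _))
  obtain ⟨s, hs⟩ := exists_desc e _ hx
  have hd : dir e x ≤ ker s := im_le.2 (ker_factors.2 (by
    rw [Category.assoc, hs, cokernel.condition]))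
  refine le_iff_factors.2 ((factors_iff _ _).2 ?_)
  rw [← hs, ← Category.assoc]
  have hu : dir e (pre (e ≫ i) (dir (e ≫ i) x)) ≤ dir e x :=
    le_of_dir_le i (by rw [← dir_comp, ← dir_comp, dir_le])
  exact ker_factors.1 (im_le.1 (hu.trans hd))

/-- The modular law, in the form used throughout: `pre f y ≤ x` when `x` contains the kernel and its
image contains `y`. -/
theorem pre_le {A B : E} {f : A ⟶ B} {x : Subobject A} {y : Subobject B} (hy : y ≤ dir f x)
    (h : ker f ≤ x) : pre f y ≤ x :=
  (pre_mono f hy).trans (pre_dir f h).le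

/-- Containment of a kernel may be tested after precomposition with an epimorphism. -/
theorem ker_le_of_epi {A B D : E} (e : A ⟶ B) [Epi e] {f : B ⟶ D} {y : Subobject B}
    (h : ker (e ≫ f) ≤ pre e y) : ker f ≤ y := by
  rw [← dir_pre_of_epi e (ker f), pre_ker, dir_le]
  exact h

/-- With `i` a monomorphism the image of `f ≫ i` determines whether `f` is an epimorphism. -/
theorem epi_of_im_le {A B D : E} (f : A ⟶ B) (i : B ⟶ D) [Mono i] (h : im i ≤ im (f ≫ i)) :
    Epi f := by
  have h₁ : (⊤ : Subobject B) ≤ im f := le_of_dir_le i ((dir_le_im _ _).trans (by rwa [dir_im]))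
  obtain ⟨I, p, j, rfl, hp, hj⟩ := exists_epi_mono_fac f
  have h₂ : im (p ≫ j) ≤ Subobject.mk j :=
    im_le.2 ((mk_factors _ _).2 ⟨p, rfl⟩)
  obtain ⟨z, hz⟩ := (mk_factors j (𝟙 B)).1
    (Subobject.factors_of_le _ (h₁.trans h₂) (Subobject.top_factors _))
  have : IsSplitEpi j := ⟨⟨⟨z, hz⟩⟩⟩
  exact epi_comp p j

/-- Exactness of `A ⟶ B ⟶ D` at `B`, as an equality of subobjects of `B`. -/
def Exact {A B D : E} (f : A ⟶ B) (g : B ⟶ D) : Prop := im f = ker g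

theorem Exact.zero {A B D : E} {f : A ⟶ B} {g : B ⟶ D} (h : Exact f g) : f ≫ g = 0 :=
  ker_factors.1 (h ▸ im_factors f)

theorem exact_of_le {A B D : E} {f : A ⟶ B} {g : B ⟶ D} (w : f ≫ g = 0) (h : ker g ≤ im f) :
    Exact f g :=
  le_antisymm (im_le.2 (ker_factors.2 w)) h

theorem Exact.exists_lift {A B D T : E} {f : A ⟶ B} {g : B ⟶ D} (h : Exact f g) [Mono f]
    (t : T ⟶ B) (ht : t ≫ g = 0) : ∃ s, s ≫ f = t := by
  have h₁ : im f ≤ Subobject.mk f := im_le.2 ((mk_factors _ _).2 ⟨𝟙 _, by simp⟩)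
  exact (mk_factors _ _).1 (Subobject.factors_of_le _ (h.ge.trans h₁)
    (ker_factors.2 ht))

theorem Exact.exists_desc {A B D T : E} {f : A ⟶ B} {g : B ⟶ D} (h : Exact f g) [Epi g]
    (t : B ⟶ T) (ht : f ≫ t = 0) : ∃ s, g ≫ s = t :=
  PuppeExact.exists_desc g t (h.ge.trans (im_le.2 (ker_factors.2 ht)))

theorem exact_of_lift {A B D : E} {f : A ⟶ B} {g : B ⟶ D} (w : f ≫ g = 0)
    (h : ∀ (T : E) (t : T ⟶ B), t ≫ g = 0 → ∃ s, s ≫ f = t) : Exact f g :=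
  exact_of_le w (ker_le.2 fun T t ht => by
    obtain ⟨s, rfl⟩ := h T t ht
    exact Subobject.factors_of_factors_right s (im_factors f))

end PuppeExact

namespace PuppeExact

/-! ### The long exact sequence in a Puppe-exact category -/

section

variable (E : Type u) [Category.{v} E] [HasZeroMorphisms E]

/-- A chain complex whose differentials are given with an epi-mono factorization
`X (i + 1) ⟶ bar (i + 1) ⟶ X i`. -/
structure FactoredComplex where
  X : ℤ → E
  bar : ℤ → E
  ε : ∀ i, X i ⟶ bar i
  μ : ∀ i, bar (i + 1) ⟶ X i
  epi_ε : ∀ i, Epi (ε i)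
  mono_μ : ∀ i, Mono (μ i)
  zero : ∀ i, μ i ≫ ε i = 0

end

attribute [instance] FactoredComplex.epi_ε FactoredComplex.mono_μ

variable {E : Type u} [Category.{v} E] [HasZeroMorphisms E]

/-- A morphism of chain complexes with factored differentials. -/
structure FactoredComplex.Hom (X Y : FactoredComplex E) where
  f : ∀ i, X.X i ⟶ Y.X i
  bar : ∀ i, X.bar i ⟶ Y.bar i
  comm_ε : ∀ i, X.ε i ≫ bar i = f i ≫ Y.ε i
  comm_μ : ∀ i, X.μ i ≫ f i = bar (i + 1) ≫ Y.μ i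

variable [PuppeExact E]

/-- Homology in degree `i`: the kernel `ι : K ⟶ X i` of the outgoing differential, and the
cokernel `π : K ⟶ H` of the map `b` induced by the incoming one. -/
structure FactoredComplex.Homology (X : FactoredComplex E) (i : ℤ) where
  K : E
  H : E
  ι : K ⟶ X.X i
  b : X.bar (i + 1) ⟶ K
  π : K ⟶ H
  mono_ι : Mono ι
  exact_ι : Exact ι (X.ε i)
  b_ι : b ≫ ι = X.μ i
  epi_π : Epi π
  exact_π : Exact b π

attribute [instance] FactoredComplex.Homology.mono_ι FactoredComplex.Homology.epi_π

/-- A short exact sequence `X ⟶ Y ⟶ Z` of complexes with factored differentials. The images of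
the differentials form a sequence `X.bar i ⟶ Y.bar i ⟶ Z.bar i` of a monomorphism and an
epimorphism, which need not be exact in the middle. -/
structure IsShortExactSeq {X Y Z : FactoredComplex E} (f : X.Hom Y) (g : Y.Hom Z) : Prop where
  mono_f : ∀ i, Mono (f.f i)
  mono_bar : ∀ i, Mono (f.bar i)
  epi_g : ∀ i, Epi (g.f i)
  epi_bar : ∀ i, Epi (g.bar i)
  exact : ∀ i, Exact (f.f i) (g.f i)

namespace FactoredComplex

variable {X Y Z : FactoredComplex E}

/-- A morphism of complexes restricts to the kernels `K` and passes to homology. -/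
theorem Hom.exists_induced (f : X.Hom Y) {i : ℤ} (hX : X.Homology i) (hY : Y.Homology i) :
    ∃ (l : hX.K ⟶ hY.K) (α : hX.H ⟶ hY.H), l ≫ hY.ι = hX.ι ≫ f.f i ∧ l ≫ hY.π = hX.π ≫ α := by
  obtain ⟨l, hl⟩ := hY.exact_ι.exists_lift (hX.ι ≫ f.f i) (by
    rw [Category.assoc, ← f.comm_ε, ← Category.assoc, hX.exact_ι.zero, zero_comp])
  have hb : hX.b ≫ l = f.bar (i + 1) ≫ hY.b := by
    rw [← cancel_mono hY.ι, Category.assoc, Category.assoc, hl, hY.b_ι, ← f.comm_μ,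
      ← Category.assoc, hX.b_ι]
  obtain ⟨α, hα⟩ := hX.exact_π.exists_desc (l ≫ hY.π) (by
    rw [← Category.assoc, hb, Category.assoc, hY.exact_π.zero, comp_zero])
  exact ⟨l, α, hl, hα.symm⟩

section

variable {f : X.Hom Y} {g : Y.Hom Z} (h : IsShortExactSeq f g) {i : ℤ} {hX : X.Homology i}
  {hY : Y.Homology i} {hZ : Z.Homology i} {l : hX.K ⟶ hY.K} {l' : hY.K ⟶ hZ.K}
  {α : hX.H ⟶ hY.H} {β : hY.H ⟶ hZ.H}

include h

/-- The kernels of the differentials of `X`, `Y`, `Z` form a sequence that is exact in the middle.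
Its last map need not be an epimorphism, which is where the connecting morphism comes from. -/
theorem exact_kernels (hl : l ≫ hY.ι = hX.ι ≫ f.f i) (hl' : l' ≫ hZ.ι = hY.ι ≫ g.f i) :
    Exact l l' := by
  have := h.mono_bar i
  refine exact_of_le ?_ (le_of_dir_le hY.ι ?_)
  · rw [← cancel_mono hZ.ι, Category.assoc, hl', ← Category.assoc, hl, Category.assoc,
      (h.exact i).zero, comp_zero, zero_comp]
  · have h₁ : dir hY.ι (ker l') ≤ im (f.f i) := by
      rw [h.exact i, dir_le, pre_ker, ← hl', ker_comp_mono]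
    rw [← dir_pre (f.f i) h₁, dir_im, hl, ← dir_im, hX.exact_ι]
    refine dir_mono _ (le_ker.2 ?_)
    rw [← cancel_mono (f.bar i), zero_comp, Category.assoc, f.comm_ε, ← Category.assoc]
    exact ker_factors.1 (Subobject.factors_of_le _ ((dir_le_im _ _).trans hY.exact_ι.le)
      (pre_factors.1 (le_iff_factors.1 le_rfl)))

/-- Exactness at the homology of `Y`. The kernel of `β` is the image in homology of the inverse
image under `l'` of the boundaries of `Z`; those are the image under `l'` of the boundaries of `Y`,
so that the modular law applies. -/
theorem exact_middle (hl : l ≫ hY.ι = hX.ι ≫ f.f i) (hl' : l' ≫ hZ.ι = hY.ι ≫ g.f i)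
    (hα : l ≫ hY.π = hX.π ≫ α) (hβ : l' ≫ hZ.π = hY.π ≫ β) : Exact α β := by
  have := h.epi_bar (i + 1)
  have hK := exact_kernels h hl hl'
  refine exact_of_le ?_ (ker_le_of_epi hY.π ?_)
  · rw [← cancel_epi hX.π, ← Category.assoc, ← hα, Category.assoc, ← hβ, ← Category.assoc, hK.zero,
      zero_comp, comp_zero]
  · have hb : hY.b ≫ l' = g.bar (i + 1) ≫ hZ.b := by
      rw [← cancel_mono hZ.ι, Category.assoc, Category.assoc, hl', hZ.b_ι, ← g.comm_μ,
        ← Category.assoc, hY.b_ι]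
    rw [← hβ, ← pre_ker, ← hZ.exact_π, ← im_epi_comp (g.bar (i + 1)), ← hb, ← dir_im, hY.exact_π]
    refine pre_le (dir_mono _ (ker_le_pre _ _)) ?_
    rw [← hK, im_le, pre_factors, hα]
    exact Subobject.factors_of_factors_right _ (im_factors _)

end

/-- A domain for the connecting morphism: `κ` is the kernel of `Y (i + 1) ⟶ Y i ⟶ Z i`, and `p`
and `q` are the restrictions to `P` of `Y (i + 1) ⟶ Z (i + 1)` and `Y (i + 1) ⟶ Y i`. -/
structure ConnectingData {f : X.Hom Y} {g : Y.Hom Z} {i : ℤ} (hX : X.Homology i)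
    (hZ : Z.Homology (i + 1)) {P : E} (κ : P ⟶ Y.X (i + 1)) (p : P ⟶ hZ.K) (q : P ⟶ hX.K) :
    Prop where
  mono_κ : Mono κ
  exact_κ : Exact κ (g.f (i + 1) ≫ Z.ε (i + 1))
  hp : p ≫ hZ.ι = κ ≫ g.f (i + 1)
  hq : q ≫ hX.ι ≫ f.f i = κ ≫ Y.ε (i + 1) ≫ Y.μ i

section

variable {f : X.Hom Y} {g : Y.Hom Z} (h : IsShortExactSeq f g) {i : ℤ} (hX : X.Homology i)
  (hZ : Z.Homology (i + 1)) {P : E} (κ : P ⟶ Y.X (i + 1))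

include h

theorem exists_connectingData (hm : Mono κ) (hκ : Exact κ (g.f (i + 1) ≫ Z.ε (i + 1))) :
    ∃ p q, ConnectingData (f := f) (g := g) hX hZ κ p q := by
  have := h.mono_f i
  have := h.mono_bar i
  obtain ⟨p, hp⟩ := hZ.exact_ι.exists_lift (κ ≫ g.f (i + 1)) (by rw [Category.assoc, hκ.zero])
  obtain ⟨q', hq'⟩ := (h.exact i).exists_lift (κ ≫ Y.ε (i + 1) ≫ Y.μ i) (by
    rw [Category.assoc, Category.assoc, g.comm_μ, ← Category.assoc (Y.ε _), g.comm_ε,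
      ← Category.assoc, hκ.zero, zero_comp])
  obtain ⟨q, hq⟩ := hX.exact_ι.exists_lift q' (by
    rw [← cancel_mono (f.bar i), Category.assoc, f.comm_ε, ← Category.assoc, hq', Category.assoc,
      Category.assoc, Y.zero, comp_zero, comp_zero, zero_comp])
  exact ⟨p, q, hm, hκ, hp, by rw [← Category.assoc, hq, hq']⟩

variable {hX hZ κ} {p : P ⟶ hZ.K} {q : P ⟶ hX.K}
  (c : ConnectingData (f := f) (g := g) hX hZ κ p q)

include c

/-- The direct image along the epimorphism `g` of the inverse image of the cycles of `Z` is the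
cycles of `Z`. -/
theorem ConnectingData.epi : Epi p := by
  have := h.epi_g (i + 1)
  refine epi_of_im_le p hZ.ι ?_
  rw [c.hp, ← dir_im, c.exact_κ, ← pre_ker, dir_pre_of_epi, hZ.exact_ι]

/-- The restriction of `X (i + 1) ⟶ Y (i + 1)` to `P`. -/
theorem ConnectingData.exists_incl : ∃ x : X.X (i + 1) ⟶ P, x ≫ κ = f.f (i + 1) ∧ Exact x p ∧
    x ≫ q = X.ε (i + 1) ≫ hX.b := by
  have := h.mono_f i
  have := c.mono_κ
  obtain ⟨x, hx⟩ := c.exact_κ.exists_lift (f.f (i + 1)) (by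
    rw [← Category.assoc, (h.exact _).zero, zero_comp])
  refine ⟨x, hx, ?_, ?_⟩
  · rw [Exact, ← ker_comp_mono p hZ.ι, c.hp, ← pre_ker, ← h.exact, ← hx, ← dir_im, pre_dir_of_mono]
  · rw [← cancel_mono (hX.ι ≫ f.f i), Category.assoc, c.hq, ← Category.assoc, hx,
      ← Category.assoc, ← f.comm_ε, Category.assoc, Category.assoc, ← f.comm_μ, ← hX.b_ι,
      Category.assoc]

/-- The connecting morphism: the kernel of `p ≫ hZ.π` is generated by the boundaries of `Y` and by
`X (i + 1)`, both of which `q ≫ hX.π` sends to zero. -/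
theorem ConnectingData.exists_desc :
    ∃ δ : hZ.H ⟶ hX.H, p ≫ hZ.π ≫ δ = q ≫ hX.π := by
  have := h.mono_f i
  have := c.mono_κ
  have := c.epi h
  have := h.epi_bar (i + 1 + 1)
  obtain ⟨x, hx, hxp, hxq⟩ := c.exists_incl h
  -- the boundaries of `Y`; those of `Z` are their image under `p`, and `q` kills them
  obtain ⟨y, hy⟩ := c.exact_κ.exists_lift (Y.μ (i + 1)) (by
    rw [← Category.assoc, g.comm_μ, Category.assoc, Z.zero, comp_zero])
  have hyp : y ≫ p = g.bar (i + 1 + 1) ≫ hZ.b := by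
    rw [← cancel_mono hZ.ι, Category.assoc, c.hp, ← Category.assoc, hy, g.comm_μ, Category.assoc,
      hZ.b_ι]
  have hyq : y ≫ q = 0 := by
    rw [← cancel_mono (hX.ι ≫ f.f i), Category.assoc, c.hq, ← Category.assoc, hy,
      ← Category.assoc, Y.zero, zero_comp, zero_comp]
  obtain ⟨δ, hδ⟩ := PuppeExact.exists_desc (p ≫ hZ.π) (q ≫ hX.π) (by
    rw [← pre_ker, ← hZ.exact_π, ← im_epi_comp (g.bar (i + 1 + 1)), ← hyp, ← dir_im]
    refine pre_le (dir_mono _ ?_) ?_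
    · rw [im_le, ker_factors, ← Category.assoc, hyq, zero_comp]
    · rw [← hxp, im_le, ker_factors, ← Category.assoc, hxq, Category.assoc, hX.exact_π.zero,
        comp_zero])
  exact ⟨δ, by rw [← Category.assoc, hδ]⟩

variable {δ : hZ.H ⟶ hX.H} (hδ : p ≫ hZ.π ≫ δ = q ≫ hX.π)

include hδ

/-- Exactness at the homology of `Z`. -/
theorem ConnectingData.exact_right {hY : Y.Homology (i + 1)} {l' : hY.K ⟶ hZ.K}
    {β : hY.H ⟶ hZ.H} (hl' : l' ≫ hZ.ι = hY.ι ≫ g.f (i + 1)) (hβ : l' ≫ hZ.π = hY.π ≫ β) :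
    Exact β δ := by
  have := h.mono_f i
  have := c.mono_κ
  have := c.epi h
  obtain ⟨x, hx, hxp, hxq⟩ := c.exists_incl h
  -- the cycles of `Y` lie in `P`, where they are the kernel of `q`
  obtain ⟨j, hj⟩ := c.exact_κ.exists_lift hY.ι (by
    rw [← g.comm_ε, ← Category.assoc, hY.exact_ι.zero, zero_comp])
  have hjp : j ≫ p = l' := by
    rw [← cancel_mono hZ.ι, Category.assoc, c.hp, ← Category.assoc, hj, hl']
  have hjq : j ≫ q = 0 := by
    rw [← cancel_mono (hX.ι ≫ f.f i), Category.assoc, c.hq, ← Category.assoc, hj,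
      ← Category.assoc, hY.exact_ι.zero, zero_comp, zero_comp]
  have hkq : ker q = im j := by
    rw [← ker_comp_mono q (hX.ι ≫ f.f i), c.hq, ← pre_ker, ker_comp_mono, ← hY.exact_ι, ← hj,
      ← dir_im, pre_dir_of_mono]
  refine exact_of_le ?_ (ker_le_of_epi (p ≫ hZ.π) ?_)
  · rw [← cancel_epi hY.π, ← Category.assoc, ← hβ, ← hjp, Category.assoc, Category.assoc, hδ,
      ← Category.assoc, hjq, zero_comp, comp_zero]
  · rw [Category.assoc, hδ, ← pre_ker, ← hX.exact_π, ← im_epi_comp (X.ε (i + 1)), ← hxq, ← dir_im]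
    refine pre_le (dir_mono _ ?_) ?_
    · rw [im_le, pre_factors, ← Category.assoc, hxp.zero, zero_comp]
      exact Subobject.factors_zero
    · rw [hkq, im_le, pre_factors, ← Category.assoc, hjp, hβ]
      exact Subobject.factors_of_factors_right _ (im_factors _)

/-- Exactness at the homology of `X`. -/
theorem ConnectingData.exact_left {hY : Y.Homology i} {l : hX.K ⟶ hY.K} {α : hX.H ⟶ hY.H}
    (hl : l ≫ hY.ι = hX.ι ≫ f.f i) (hα : l ≫ hY.π = hX.π ≫ α) : Exact δ α := by
  have := h.mono_f i
  have := c.epi h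
  have hql : q ≫ l = κ ≫ Y.ε (i + 1) ≫ hY.b := by
    rw [← cancel_mono hY.ι, Category.assoc, hl, c.hq]
    simp only [Category.assoc, hY.b_ι]
  refine exact_of_le ?_ (ker_le_of_epi hX.π ?_)
  · rw [← cancel_epi (p ≫ hZ.π), ← Category.assoc, Category.assoc p, hδ, Category.assoc, ← hα,
      ← Category.assoc, hql]
    simp only [Category.assoc, hY.exact_π.zero, comp_zero]
  -- a cycle of `X` that is a boundary of `Y` lies in the image of `q`
  · have h₁ : pre l (ker hY.π) ≤ im q := by
      refine le_of_dir_le (hX.ι ≫ f.f i) ?_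
      have h₂ : dir (hX.ι ≫ f.f i) (pre l (ker hY.π)) ≤ im (Y.ε (i + 1) ≫ Y.μ i) := by
        rw [im_epi_comp, ← hY.b_ι, ← dir_im, hY.exact_π, ← hl, dir_comp]
        exact dir_mono _ (dir_le.2 le_rfl)
      rw [← dir_pre _ h₂, dir_im, c.hq, ← dir_im, c.exact_κ]
      refine dir_mono _ (le_ker.2 ?_)
      have h₃ : dir (hX.ι ≫ f.f i) (pre l (ker hY.π)) ≤ ker (g.f i) := by
        rw [dir_comp, ← h.exact]
        exact dir_le_im _ _
      rw [← cancel_mono (Z.μ i), zero_comp, ← g.comm_ε, Category.assoc, Category.assoc, ← g.comm_μ]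
      have h₄ := pre_factors.1 (le_iff_factors.1 (le_refl
        (pre (Y.ε (i + 1) ≫ Y.μ i) (dir (hX.ι ≫ f.f i) (pre l (ker hY.π))))))
      simpa only [Category.assoc] using ker_factors.1 (Subobject.factors_of_le _ h₃ h₄)
    rw [← hα, ← pre_ker]
    refine h₁.trans ?_
    rw [im_le, pre_factors, ← hδ, ← Category.assoc]
    exact Subobject.factors_of_factors_right _ (im_factors _)

end

end FactoredComplex

end PuppeExact

namespace ACGWCategory

variable {C : Type u} [Category.{v} (HorObj C)] [Category.{w} (VerObj C)] [ACGWCategory C]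

/-! ### The flattening of an ACGW category -/

/-- Over every horizontal morphism there is a square with corner `∅`: in terms of kernels, the
kernels of `∅ ⤏ A` and `∅ ⤏ B` are identities. -/
theorem sq_vzero {A B : C} (f : Hor A B) : Sq (hid zero) (vzero A) (vzero B) f := by
  obtain ⟨θ, hθ⟩ := exists_k_vzero A
  obtain ⟨η, hη⟩ := exists_k_vzero B
  have hθ' : k (vzero A) = θ.inv := by rw [← cancel_epi θ.hom, hθ, Iso.hom_inv_id]
  have hη' : k (vzero B) = η.inv := by rw [← cancel_epi η.hom, hη, Iso.hom_inv_id]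
  have hp : IsPullback (θ.inv ≫ f ≫ η.hom) (k (vzero A)) (k (vzero B)) f := by
    rw [hθ', hη']
    exact IsPullback.of_vert_isIso ⟨by simp⟩
  obtain ⟨h, hh, -⟩ := k_ff (vzero A) (vzero B) f _ hp
  rwa [horInitial.hom_ext h (hid zero)] at hh

theorem sq_hzero {A B : C} (a : Ver A B) : Sq (hzero A) (vid zero) a (hzero B) := by
  obtain ⟨θ, hθ⟩ := exists_c_hzero A
  obtain ⟨η, hη⟩ := exists_c_hzero B
  have hθ' : c (hzero A) = θ.inv := by rw [← cancel_epi θ.hom, hθ, Iso.hom_inv_id]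
  have hη' : c (hzero B) = η.inv := by rw [← cancel_epi η.hom, hη, Iso.hom_inv_id]
  have hp : IsPullback (θ.inv ≫ a ≫ η.hom) (c (hzero A)) (c (hzero B)) a := by
    rw [hθ', hη']
    exact IsPullback.of_vert_isIso ⟨by simp⟩
  obtain ⟨h, hh, -⟩ := c_ff (hzero A) a (hzero B) _ hp
  rwa [verInitial.hom_ext h (vid zero)] at hh

/-- The corner of a square may be replaced by an isomorphic object. -/
theorem sq_corner {T A B A' B' : C} {f : Hor A B} {a : Ver A A'} {b : Ver B B'} {g : Hor A' B'}
    (θ : HorIso T A) (h : Sq f a b g) : Sq (θ.hom ≫ f) ((φ θ).hom ≫ a) b g := by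
  have h₁ : Sq θ.hom (φ θ).hom (vid A) (hid A) :=
    (sq_horIso θ (φ θ).hom (vid A) (Iso.refl _)).2 (by simp [φ_refl])
  have h₂ := sq_vcomp (sq_hcomp h₁ (sq_vid f)) (by rwa [Category.id_comp])
  rwa [Category.id_comp] at h₂

theorem flat_comp {A B D T : C} {s : Span A B} {t : Span B D} {f : Hor T t.mid}
    {a : Ver T s.mid} (h : Sq f a t.e s.m) :
    s.flat ≫ t.flat = Span.flat ⟨T, a ≫ s.e, f ≫ t.m⟩ :=
  flatComp_mk h

theorem flat_eq_iff {A B : C} {s t : Span A B} : s.flat = t.flat ↔ Span.Isom s t :=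
  ⟨fun h => Quotient.exact h, fun h => Quotient.sound h⟩

theorem exists_flat {A B : Flat C} (f : A ⟶ B) : ∃ s : Span A.of B.of, s.flat = f :=
  Quotient.exists_rep f

theorem span_flat {A B : C} (s : Span A B) : s.flat = flatVer s.e ≫ flatHor s.m := by
  refine ((flat_comp (s := ⟨s.mid, s.e, hid _⟩) (t := ⟨s.mid, vid _, s.m⟩)
    (sq_vid (hid s.mid))).trans ?_).symm
  simp

theorem flat_comp_flatHor {A B D : C} (s : Span A B) (m : Hor B D) :
    s.flat ≫ flatHor m = Span.flat ⟨s.mid, s.e, s.m ≫ m⟩ := by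
  refine (flat_comp (t := ⟨B, vid _, m⟩) (sq_vid s.m)).trans ?_
  simp

theorem flatVer_comp_flat {A B D : C} (e : Ver B A) (s : Span B D) :
    flatVer e ≫ s.flat = Span.flat ⟨s.mid, s.e ≫ e, s.m⟩ := by
  refine (flat_comp (s := ⟨B, e, hid _⟩) (sq_hid s.e)).trans ?_
  simp

theorem flatHor_comp {A B D : C} (f : Hor A B) (g : Hor B D) :
    flatHor (f ≫ g) = flatHor f ≫ flatHor g :=
  (flat_comp_flatHor ⟨A, vid _, f⟩ g).symm

theorem flatVer_comp {A B D : C} (a : Ver A B) (b : Ver B D) :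
    flatVer (a ≫ b) = flatVer b ≫ flatVer a :=
  (flatVer_comp_flat b ⟨A, a, hid _⟩).symm

/-- The squares of the double category commute in the flattening. -/
theorem flat_sq {A B A' B' : C} {f : Hor A B} {a : Ver A A'} {b : Ver B B'} {g : Hor A' B'}
    (h : Sq f a b g) : flatHor g ≫ flatVer b = flatVer a ≫ flatHor f := by
  rw [← span_flat ⟨A, a, f⟩]
  refine (flat_comp (s := ⟨A', vid _, g⟩) (t := ⟨B, b, hid _⟩) h).trans ?_
  simp

instance mono_flatHor {A B : C} (m : Hor A B) : Mono (flatHor m) where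
  right_cancellation := by
    intro T f g h
    obtain ⟨s, rfl⟩ := exists_flat f
    obtain ⟨t, rfl⟩ := exists_flat g
    have := hor_mono m
    rw [flat_comp_flatHor, flat_comp_flatHor, flat_eq_iff] at h
    obtain ⟨θ, h₁, h₂⟩ := h
    refine flat_eq_iff.2 ⟨θ, ?_, h₂⟩
    rw [← cancel_mono m, Category.assoc]
    exact h₁

instance epi_flatVer {A B : C} (e : Ver A B) : Epi (flatVer e) where
  left_cancellation := by
    intro T f g h
    obtain ⟨s, rfl⟩ := exists_flat f
    obtain ⟨t, rfl⟩ := exists_flat g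
    have := ver_mono e
    rw [flatVer_comp_flat, flatVer_comp_flat, flat_eq_iff] at h
    obtain ⟨θ, h₁, h₂⟩ := h
    refine flat_eq_iff.2 ⟨θ, h₁, ?_⟩
    rw [← cancel_mono e, Category.assoc]
    exact h₂

/-- A horizontal morphism that factors in the flattening through another one factors through it
in the horizontal category. -/
theorem exists_hor_of_flat {A B D : C} {m : Hor A B} {m' : Hor D B} (t : Flat.mk A ⟶ Flat.mk D)
    (h : t ≫ flatHor m' = flatHor m) : ∃ r : Hor A D, r ≫ m' = m := by
  obtain ⟨s, rfl⟩ := exists_flat t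
  rw [flat_comp_flatHor] at h
  obtain ⟨θ, h₁, -⟩ := flat_eq_iff.1 h
  refine ⟨θ.inv ≫ s.m, ?_⟩
  rw [Category.assoc]
  exact (Iso.inv_comp_eq _).2 h₁.symm

/-! ### Zero morphisms, kernels and cokernels of the flattening -/

/-- The spans through `∅` are zero morphisms. -/
instance : HasZeroMorphisms (Flat C) where
  zero A B := ⟨Span.flat ⟨zero, vzero A.of, hzero B.of⟩⟩
  comp_zero := by
    intro A B f D
    obtain ⟨s, rfl⟩ := exists_flat f
    refine (flat_comp (t := ⟨zero, vzero B.of, hzero D.of⟩) (sq_vzero s.m)).trans ?_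
    rw [verInitial.hom_ext (vzero s.mid ≫ s.e) (vzero A.of), Category.id_comp]
    rfl
  zero_comp := by
    intro A B D f
    obtain ⟨s, rfl⟩ := exists_flat f
    refine (flat_comp (s := ⟨zero, vzero A.of, hzero B.of⟩) (sq_hzero s.e)).trans ?_
    rw [horInitial.hom_ext (hzero s.mid ≫ s.m) (hzero D.of), Category.id_comp]
    rfl

theorem flat_zero (A B : C) :
    (0 : Flat.mk A ⟶ Flat.mk B) = Span.flat ⟨zero, vzero A, hzero B⟩ := rfl

/-- The chain condition of the flattening is the square condition of the double category. -/
theorem flatHor_flatVer_eq_zero {A B D : C} {m : Hor A B} {e : Ver D B} :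
    flatHor m ≫ flatVer e = 0 ↔ Sq (hzero D) (vzero A) e m := by
  constructor
  · intro h
    obtain ⟨T, f, a, q⟩ := exists_oslash m e
    rw [flat_sq q, ← span_flat ⟨T, a, f⟩, flat_zero] at h
    obtain ⟨θ, -, -⟩ := flat_eq_iff.1 h
    have q' := sq_corner θ.symm q
    rwa [horInitial.hom_ext (θ.symm.hom ≫ f) (hzero D),
      verInitial.hom_ext ((φ θ.symm).hom ≫ a) (vzero A)] at q'
  · intro h
    rw [flat_sq h, ← span_flat ⟨zero, vzero A, hzero D⟩]
    rfl

theorem sq_of_isComplement {A B D : C} {m : Hor A B} {e : Ver D B} (h : IsComplement m e) :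
    Sq (hzero D) (vzero A) e m := by
  obtain ⟨θ, rfl⟩ := h
  have h₁ : Sq (hzero D) (vid zero) θ.hom (hzero (cObj m)) := sq_hzero θ.hom
  simpa using sq_vcomp h₁ (c_disjoint m)

theorem isComplement_k {A B : C} (e : Ver A B) : IsComplement (k e) e := c_k e

theorem isComplement_c {A B : C} (m : Hor A B) : IsComplement m (c m) :=
  ⟨Iso.refl _, by simp⟩

theorem isComplement_of_iso {A A' B D : C} {m : Hor A B} {m' : Hor A' B} {e : Ver D B}
    (θ : HorIso A A') (hθ : θ.hom ≫ m' = m) (h : IsComplement m' e) : IsComplement m e := by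
  obtain ⟨η, hη⟩ := h
  obtain ⟨z, hz⟩ := exists_c_iso θ hθ
  exact ⟨η ≪≫ z.symm, by simp [← hz, hη]⟩

theorem exists_iso_k {A B D : C} {m : Hor A B} {e : Ver D B} (h : IsComplement m e) :
    ∃ θ : HorIso (kObj e) A, θ.hom ≫ m = k e := by
  obtain ⟨η, hη⟩ := h
  obtain ⟨ζ, hζ⟩ := c_k e
  obtain ⟨θ, hθ, -⟩ := exists_iso_of_c (k e) m (ζ.symm ≪≫ η) (by simp [hη, ← hζ])
  exact ⟨θ, hθ⟩

/-- A horizontal morphism meeting `e` in `∅` factors through every complement of `e`. -/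
theorem exists_hor_lift {A B D S : C} {m : Hor A B} {e : Ver D B} (h : IsComplement m e)
    {n : Hor S B} (hn : Sq (hzero D) (vzero S) e n) : ∃ r : Hor S A, r ≫ m = n := by
  obtain ⟨t, ht⟩ := k_sq hn
  obtain ⟨θ, hθ⟩ := exists_k_vzero S
  obtain ⟨η, hη⟩ := exists_iso_k h
  refine ⟨θ.hom ≫ t ≫ η.hom, ?_⟩
  rw [Category.assoc, Category.assoc, hη, ht.w, ← Category.assoc, hθ, Category.id_comp]

/-- A vertical morphism meeting `m` in `∅` factors through every complement of `m`. -/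
theorem exists_ver_lift {A B D S : C} {m : Hor A B} {e : Ver D B} (h : IsComplement m e)
    {n : Ver S B} (hn : Sq (hzero S) (vzero A) n m) : ∃ r : Ver S D, r ≫ e = n := by
  obtain ⟨t, ht⟩ := c_sq hn
  obtain ⟨θ, hθ⟩ := exists_c_hzero S
  obtain ⟨η, hη⟩ := h
  refine ⟨θ.hom ≫ t ≫ η.inv, ?_⟩
  rw [Category.assoc, Category.assoc, (Iso.inv_comp_eq η).2 hη.symm, ht.w, ← Category.assoc, hθ,
    Category.id_comp]

theorem flatHor_comp_flatVer {A B D : C} {m : Hor A B} {e : Ver D B} (h : IsComplement m e) :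
    flatHor m ≫ flatVer e = 0 :=
  flatHor_flatVer_eq_zero.2 (sq_of_isComplement h)

theorem exists_flat_lift {A B D : C} {m : Hor A B} {e : Ver D B} (h : IsComplement m e)
    {T : Flat C} (t : T ⟶ Flat.mk B) (ht : t ≫ flatVer e = 0) : ∃ r, r ≫ flatHor m = t := by
  obtain ⟨s, rfl⟩ := exists_flat t
  rw [span_flat, Category.assoc] at ht
  obtain ⟨r, hr⟩ := exists_hor_lift h (flatHor_flatVer_eq_zero.1 (zero_of_epi_comp _ ht))
  exact ⟨flatVer s.e ≫ flatHor r, by rw [Category.assoc, ← flatHor_comp, hr, ← span_flat]⟩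

theorem exists_flat_desc {A B D : C} {m : Hor A B} {e : Ver D B} (h : IsComplement m e)
    {T : Flat C} (t : Flat.mk B ⟶ T) (ht : flatHor m ≫ t = 0) : ∃ r, flatVer e ≫ r = t := by
  obtain ⟨s, rfl⟩ := exists_flat t
  rw [span_flat, ← Category.assoc] at ht
  obtain ⟨r, hr⟩ := exists_ver_lift h (flatHor_flatVer_eq_zero.1 (zero_of_comp_mono _ ht))
  exact ⟨flatVer r ≫ flatHor s.m, by rw [← Category.assoc, ← flatVer_comp, hr, ← span_flat]⟩

/-- The horizontal member of a complementary pair is the kernel of the vertical one. -/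
noncomputable def isLimitOfIsComplement {A B D : C} {m : Hor A B} {e : Ver D B}
    (h : IsComplement m e) : IsLimit (KernelFork.ofι (flatHor m) (flatHor_comp_flatVer h)) :=
  KernelFork.IsLimit.ofι' _ _ fun t ht =>
    ⟨(exists_flat_lift h t ht).choose, (exists_flat_lift h t ht).choose_spec⟩

/-- The vertical member of a complementary pair is the cokernel of the horizontal one. -/
noncomputable def isColimitOfIsComplement {A B D : C} {m : Hor A B} {e : Ver D B}
    (h : IsComplement m e) :
    IsColimit (CokernelCofork.ofπ (flatVer e) (flatHor_comp_flatVer h)) :=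
  CokernelCofork.IsColimit.ofπ' _ _ fun t ht =>
    ⟨(exists_flat_desc h t ht).choose, (exists_flat_desc h t ht).choose_spec⟩

/-- The factorization of a span `A ⤎ S ↣ B` is `A ⟶ S ⟶ B`; normality of both factors is the
fact that complementary pairs are kernel-cokernel pairs. -/
instance : PuppeExact (Flat C) where
  hasKernels := ⟨fun {A B} f => by
    obtain ⟨s, rfl⟩ := exists_flat f
    have h := isKernelCompMono (isLimitOfIsComplement (isComplement_k s.e)) (flatHor s.m)
      (span_flat s)
    exact ⟨⟨_, h⟩⟩⟩
  hasCokernels := ⟨fun {A B} f => by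
    obtain ⟨s, rfl⟩ := exists_flat f
    have h := isCokernelEpiComp (isColimitOfIsComplement (isComplement_c s.m)) (flatVer s.e)
      (span_flat s)
    exact ⟨⟨_, h⟩⟩⟩
  exists_fac := by
    intro A B f
    obtain ⟨s, rfl⟩ := exists_flat f
    exact ⟨_, flatVer s.e, flatHor s.m, (span_flat s).symm,
      ⟨⟨_, flatHor (k s.e), _, isColimitOfIsComplement (isComplement_k s.e)⟩⟩,
      ⟨⟨_, flatVer (c s.m), _, isLimitOfIsComplement (isComplement_c s.m)⟩⟩⟩

theorem exact_of_isComplement {A B D : C} {m : Hor A B} {e : Ver D B} (h : IsComplement m e) :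
    PuppeExact.Exact (flatHor m) (flatVer e) :=
  PuppeExact.exact_of_lift (flatHor_comp_flatVer h) fun _ t ht => exists_flat_lift h t ht

/-- Exactness in the flattening means that the image of the first span and the coimage of the
second are complementary. -/
theorem isComplement_of_exact {A B D : C} {s : Span A B} {t : Span B D}
    (h : PuppeExact.Exact s.flat t.flat) : IsComplement s.m t.e := by
  have h' : PuppeExact.Exact (flatHor s.m) (flatVer t.e) := by
    rwa [PuppeExact.Exact, span_flat s, span_flat t, PuppeExact.im_epi_comp,
      PuppeExact.ker_comp_mono] at h
  have hk := isComplement_k t.e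
  obtain ⟨r, hr⟩ := exists_flat_lift hk _ h'.zero
  obtain ⟨r', hr'⟩ := h'.exists_lift _ (flatHor_comp_flatVer hk)
  obtain ⟨x, hx⟩ := exists_hor_of_flat r hr
  obtain ⟨y, hy⟩ := exists_hor_of_flat r' hr'
  have := hor_mono s.m
  have := hor_mono (k t.e)
  exact isComplement_of_iso
    ⟨x, y, by rw [← cancel_mono s.m, Category.assoc, hy, hx, Category.id_comp],
      by rw [← cancel_mono (k t.e), Category.assoc, hx, hy, Category.id_comp]⟩ hx hk

/-- The homology of a complementary pair is `∅`. -/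
theorem exists_homologyData_zero {A B D : C} {m : Hor A B} {e : Ver D B} (h : IsComplement m e) :
    ∃ d : HomologyData m e, Nonempty (HorIso d.H zero) := by
  obtain ⟨θ, -, -⟩ := oslash_unique (c_disjoint (hid A)) (sq_hid (c (hid A)))
  obtain ⟨η, hη⟩ := exists_c_hzero D
  exact ⟨⟨A, D, zero, m, e, h, h, hid A, Category.id_comp _, vid D, Category.id_comp _, vzero A,
    hzero D, ⟨φ θ, verInitial.hom_ext _ _⟩, ⟨η, hη⟩, sq_of_isComplement h⟩, ⟨Iso.refl _⟩⟩

end ACGWCategory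

/-! ### The long exact sequence of an ACGW category -/

namespace ACGWChainComplex

open PuppeExact

variable {C : Type u} [Category.{v} (HorObj C)] [Category.{w} (VerObj C)] [ACGWCategory C]

/-- A chain complex in an ACGW category as a chain complex in its flattening. -/
def toFactored (X : ACGWChainComplex C) : FactoredComplex (Flat C) where
  X i := ⟨X.X i⟩
  bar i := ⟨X.bar i⟩
  ε i := flatVer (X.e i)
  μ i := flatHor (X.m i)
  epi_ε _ := inferInstance
  mono_μ _ := inferInstance
  zero i := flatHor_flatVer_eq_zero.2 (X.isComplex i)

/-- The homology of a complex is its homology in the flattening. -/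
def Homology.toFactored {X : ACGWChainComplex C} {i : ℤ} (h : X.Homology i) :
    X.toFactored.Homology i where
  K := ⟨h.Z⟩
  H := ⟨h.H⟩
  ι := flatHor h.ι
  b := flatHor h.b
  π := flatVer h.π
  mono_ι := mono_flatHor h.ι
  exact_ι := exact_of_isComplement h.isKernel
  b_ι := (flatHor_comp h.b h.ι).symm.trans (congrArg flatHor h.b_ι)
  epi_π := epi_flatVer h.π
  exact_π := exact_of_isComplement h.isComplement_π

/-- A horizontal morphism of complexes as a morphism in the flattening. -/
def HorHom.toFactored {X Y : ACGWChainComplex C} (f : HorHom X Y) :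
    X.toFactored.Hom Y.toFactored where
  f i := flatHor (f.f i)
  bar i := flatHor (f.bar i)
  comm_ε i := (flat_sq (f.sq i)).symm
  comm_μ i := by
    change flatHor _ ≫ flatHor _ = flatHor _ ≫ flatHor _
    rw [← flatHor_comp, ← flatHor_comp, f.comm]

/-- A vertical morphism of complexes as a morphism, in the opposite direction, in the
flattening. -/
def VerHom.toFactored {Z Y : ACGWChainComplex C} (g : VerHom Z Y) :
    Y.toFactored.Hom Z.toFactored where
  f i := flatVer (g.g i)
  bar i := flatVer (g.bar i)
  comm_ε i := by
    change flatVer _ ≫ flatVer _ = flatVer _ ≫ flatVer _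
    rw [← flatVer_comp, ← flatVer_comp, g.comm]
  comm_μ i := flat_sq (g.sq i)

theorem IsShortExact.toFactored {X Y Z : ACGWChainComplex C} {f : HorHom X Y} {g : VerHom Z Y}
    (h : IsShortExact f g) : IsShortExactSeq f.toFactored g.toFactored where
  mono_f i := mono_flatHor (f.f i)
  mono_bar i := mono_flatHor (f.bar i)
  epi_g i := epi_flatVer (g.g i)
  epi_bar i := epi_flatVer (g.bar i)
  exact i := exact_of_isComplement (h i)

end ACGWChainComplex


theorem theorem4p5 {C : Type u} [Category.{v} (HorObj C)] [Category.{w} (VerObj C)]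
    [ACGWCategory C] {X Y Z : ACGWChainComplex C} (f : HorHom X Y) (g : VerHom Z Y)
    (hfg : IsShortExact f g) (hX : ∀ i, X.Homology i) (hY : ∀ i, Y.Homology i)
    (hZ : ∀ i, Z.Homology i) :
    ∃ (α : ∀ i, Span (hX i).H (hY i).H) (β : ∀ i, Span (hY i).H (hZ i).H)
      (δ : ∀ i, Span (hZ (i + 1)).H (hX i).H),
      (∀ i, Induces (hX i) (hY i) (flatHor (f.f i)) (α i).flat) ∧
      (∀ i, Induces (hY i) (hZ i) (flatVer (g.g i)) (β i).flat) ∧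
      (∀ i, IsConnecting f g (hZ (i + 1)) (hX i) (δ i).flat) ∧
      (longSequence α β δ).IsExact := by
  have h := IsShortExact.toFactored hfg
  choose l α' hl hα using fun i => f.toFactored.exists_induced (hX i).toFactored (hY i).toFactored
  choose l' β' hl' hβ using fun i => g.toFactored.exists_induced (hY i).toFactored (hZ i).toFactored
  let κ (i : ℤ) := k (Z.e (i + 1) ≫ g.g (i + 1))
  have hκ (i : ℤ) : IsComplement (κ i) (Z.e (i + 1) ≫ g.g (i + 1)) := isComplement_k _
  choose p q hc using fun i => PuppeExact.FactoredComplex.exists_connectingData h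
    (hX i).toFactored (hZ (i + 1)).toFactored (flatHor (κ i)) (mono_flatHor (κ i)) (by
      have := exact_of_isComplement (hκ i)
      rwa [flatVer_comp] at this)
  choose δ' hδ using fun i => (hc i).exists_desc h
  choose α hα' using fun i => exists_flat (α' i)
  choose β hβ' using fun i => exists_flat (β' i)
  choose δ hδ' using fun i => exists_flat (δ' i)
  obtain rfl : (fun i => (α i).flat) = α' := funext hα'
  obtain rfl : (fun i => (β i).flat) = β' := funext hβ'
  obtain rfl : (fun i => (δ i).flat) = δ' := funext hδ'
  have hex : ∀ j, IsComplement ((longSequence α β δ).m j) ((longSequence α β δ).e j) := by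
    rintro (i | i | i)
    · exact isComplement_of_exact (s := δ i) (t := α i)
        ((hc i).exact_left h (hδ i) (hl i) (hα i))
    · exact isComplement_of_exact (s := α i) (t := β i)
        (PuppeExact.FactoredComplex.exact_middle h (hl i) (hl' i) (hα i) (hβ i))
    · exact isComplement_of_exact (s := β (i + 1)) (t := δ i)
        ((hc i).exact_right h (hδ i) (hl' (i + 1)) (hβ (i + 1)))
  refine ⟨α, β, δ, fun i => ⟨l i, hl i, hα i⟩, fun i => ⟨l' i, hl' i, hβ i⟩,
    fun i => ⟨_, κ i, p i, q i, hκ i, (hc i).hp, ?_, hδ i⟩,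
    fun j => sq_of_isComplement (hex j), fun j => exists_homologyData_zero (hex j)⟩
  rw [span_flat]
  exact (hc i).hq
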